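/- **Setting.** Let $M$ be a non-empty finite set of agents (write $|M|$ for its size), $\theta^*\in\mathbb R^d$, and let $X\subset\mathbb R^d$ be a non-empty finite action set with $K=|X|$ that is available to every agent at every time-step. An agent that plays $x\in X$ at a time-step observes $\langle\theta^*,x\rangle+\eta$, where the noise variables $\eta$ of all agents and time-steps are i.i.d., zero-mean and sub-Gaussian. Put $D=\max_{x,x'\in X}\langle\theta^*,x-x'\rangle$, the largest per-step regret (if per-step regrets are at most $1$, then $D\le 1$). A single-agent algorithm $\textsc{Sin}$ on $X$ is a possibly randomized rule that chooses the next action in $X$ from the history of its actions and rewards. Let $R(t)$ be its expected pseudo-regret over $t$ steps on this instance, i.e. $R(t)=\sum_{s\le t}\big(\max_{x\in X}\langle\theta^*,x\rangle-\mathbb E\langle\theta^*,x_s\rangle\big)$, and for integers $t,g,h\ge1$ put $$R'(t,h)=\frac{R(t+h)-R(t)}{h},\qquad R''(t,g,h)=\frac{R'(t+g,h)-R'(t,h)}{g}.$$ A coalition $C\subseteq M$ runs the meta-algorithm $\textsc{Mul}$: it keeps a reward buffer $B_x$ for each $x\in X$, all initially empty, and a simulated history, initially empty. At each time-step $1,\dots,T$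 every agent of $C$ plays the action $\bar x$ that $\textsc{Sin}$ requests on the simulated history, and the $|C|$ observed rewards are put into $B_{\bar x}$. Then, as long as the buffer $B_{\bar x}$ of the currently requested action $\bar x$ is non-empty, one reward $\bar y$ is removed from it, $(\bar x,\bar y)$ is appended to the simulated history, and $\textsc{Sin}$ is asked for the next action. The reward to be removed is chosen by any rule that may depend on the simulated history, but does not look at rewards that have not been removed yet. Let $R^C_a$ be the expected pseudo-regret of agent $a\in C$ over the $T$ time-steps, and $v_T(C)=-\sum_{a\in C}R^C_a$. The game $(M,v_T)$ is *convex* if $v_T(S\cup\{a\})-v_T(S)\le v_T(Q\cup\{a\})-v_T(Q)$ for all $S\subseteq Q\subseteq M\setminus\{a\}$. **Theorem.** 1. Let $T\ge 1$ be a horizon for which there are numbers $\upsilon_t>0$ ($1\le t\le |M|T$) and constants $c,\varepsilon>0$ with $$-c\,t^{-2+\varepsilon}\;\le\;R''(t,g,h)\;\le\;-\upsilon_t\qquad\text{for all integers }t,g,h\ge1\text{ with }t+g+h\le |M|T .$$ If $T$ is large enough in the sense that $T\ge\sqrt{4|M|KD/\min_{1\le t\le |M|T}\upsilon_t}$, then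 the game $(M,v_T)$ is convex. 2. In particular, suppose that for some $c>0$ and $0<\varepsilon<2$ one has $R''(t,g,h)\le -c\,(t+g+h)^{-2+\varepsilon}$ for all integers $t,g,h\ge1$. Then $(M,v_T)$ is convex for all sufficiently large $T$, namely for every $T\ge\big(4KD\,|M|^{3-\varepsilon}/c\big)^{1/\varepsilon}$. -/

import Mathlib

open MeasureTheory ProbabilityTheory

/-! ## Bandit instances -/

/-- The ambient Euclidean space of actions and parameters. -/
abbrev Act (d : ℕ) : Type := EuclideanSpace ℝ (Fin d)

/-- A multi-agent linear bandit instance with agents `ι`: the unknown parameter `θ*`, the action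
sets `X_{a,t}` (the index `t : ℕ` stands for the time-step `t + 1`), and the common law of the
i.i.d. zero-mean sub-Gaussian reward noise. -/
structure BanditInstance (d : ℕ) (ι : Type*) where
  theta : Act d
  actions : ι → ℕ → Set (Act d)
  noise : Measure ℝ
  noise_prob : IsProbabilityMeasure noise
  noise_mean : ∫ z, z ∂noise = 0
  noise_subgaussian : ∃ σ, HasSubgaussianMGF id σ noise

/-- All agents have the same finite action set `X` at all time-steps. -/
def BanditInstance.IsFixed {d : ℕ} {ι : Type*} (I : BanditInstance d ι) (X : Finset (Act d)) :
    Prop :=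
  ∀ a t, I.actions a t = (X : Set (Act d))

/-- The instance as seen by the members of a coalition. -/
def BanditInstance.restrict {d : ℕ} {A : Type*} (I : BanditInstance d A) (C : Finset A) :
    BanditInstance d C where
  theta := I.theta
  actions := fun a t => I.actions a t
  noise := I.noise
  noise_prob := I.noise_prob
  noise_mean := I.noise_mean
  noise_subgaussian := I.noise_subgaussian

/-! ## Algorithms, histories and regret -/

/-- A multi-agent algorithm for the agents `ι` with internal randomness in `Ω`: from the internal
randomness and the joint history (oldest entry first) it produces the action of every agent. -/
abbrev MultiAlg (d : ℕ) (ι : Type*) (Ω : Type*) :=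
  Ω → List (ι → Act d × ℝ) → ι → Act d

/-- The joint history after `t` time-steps when the internal randomness is `w` and the noise
variables are `η`: agent `a` plays `x` and observes `⟨θ*, x⟩ + η_{a,t}`. -/
noncomputable def BanditInstance.history {d : ℕ} {ι Ω : Type*} (I : BanditInstance d ι)
    (alg : MultiAlg d ι Ω) (w : Ω) (η : ι × ℕ → ℝ) : ℕ → List (ι → Act d × ℝ)
  | 0 => []
  | t + 1 => I.history alg w η t ++
      [fun a => (alg w (I.history alg w η t) a,
        inner ℝ I.theta (alg w (I.history alg w η t) a) + η (a, t))]

/-- Expected pseudo-regret of agent `a` over `T` time-steps, the expectation being over the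
internal randomness of the algorithm (law `P`) and the independent i.i.d. noise variables. -/
noncomputable def BanditInstance.regret {d : ℕ} {ι Ω : Type*} [MeasurableSpace Ω]
    (I : BanditInstance d ι) (P : Measure Ω) (alg : MultiAlg d ι Ω) (T : ℕ) (a : ι) : ℝ :=
  ∑ t ∈ Finset.range T,
    (sSup ((fun x => inner ℝ I.theta x) '' I.actions a t) -
      ∫ ω : Ω × (ι × ℕ → ℝ), inner ℝ I.theta (alg ω.1 (I.history alg ω.1 ω.2 t) a)
        ∂(P.prod (Measure.infinitePi fun _ : ι × ℕ => I.noise)))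

/-- The collaboration game `v(C) = - ∑_{a ∈ C} R^C_a`, every coalition running its own copy of the
algorithm and seeing only its own histories. -/
noncomputable def BanditInstance.value {d : ℕ} {A Ω : Type*} [MeasurableSpace Ω]
    (I : BanditInstance d A) (P : Measure Ω) (alg : ∀ C : Finset A, MultiAlg d C Ω) (T : ℕ)
    (C : Finset A) : ℝ :=
  - ∑ a : C, (I.restrict C).regret P (alg C) T a

/-- Convexity (supermodularity) of a TU game. -/
def IsConvexGame {A : Type*} [DecidableEq A] (v : Finset A → ℝ) : Prop :=
  ∀ (i : A) (C D : Finset A), C ⊆ D → i ∉ D → v (insert i C) - v C ≤ v (insert i D) - v D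

/-- A (possibly randomized) single-agent algorithm on the action set `X`: a measurable
function of the internal randomness and of the action-reward history (oldest entry first). -/
structure SingleAlg (d : ℕ) (X : Finset (Act d)) (Ω : Type*) [MeasurableSpace Ω] where
  act : Ω → List (Act d × ℝ) → Act d
  act_mem : ∀ w h, act w h ∈ X
  measurable_act : ∀ n : ℕ,
    Measurable fun p : Ω × (Fin n → Act d × ℝ) => act p.1 (List.ofFn p.2)

/-- `R_a(Sin, I, T)`: the regret of agent `a` when it forms a singleton coalition and runs the
single-agent algorithm. -/
noncomputable def BanditInstance.singleRegret {d : ℕ} {A Ω : Type*} [MeasurableSpace Ω]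
    (I : BanditInstance d A) (P : Measure Ω) {X : Finset (Act d)} (S : SingleAlg d X Ω) (a : A)
    (T : ℕ) : ℝ :=
  (I.restrict {a}).regret P
    (fun w H _ => S.act w (H.map fun p => p ⟨a, Finset.mem_singleton_self a⟩)) T
    ⟨a, Finset.mem_singleton_self a⟩

/-! ## The buffer-based multi-agent meta-algorithm -/

/-- The rule by which one of the rewards left in a buffer is removed. The rule is
arbitrary, except that it cannot look at rewards which have not been read yet: given the
simulated history, the requested action and the set of agents whose latest reward for that action
is still in the buffer, it names one of these agents. -/
structure RemovalRule (d : ℕ) (ι : Type*) where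
  pick : List (Act d × ℝ) → Act d → (B : Finset ι) → B.Nonempty → ι
  pick_mem : ∀ h x B hB, pick h x B hB ∈ B
  measurable_pick : ∀ (n : ℕ) (x : Act d) (B : Finset ι) (hB : B.Nonempty) (b : ι),
    MeasurableSet {h : Fin n → Act d × ℝ | pick (List.ofFn h) x B hB = b}

/-- State of the meta-algorithm: the simulated single-agent history, and for every action `x` the
buffer `B_x = {val x b : b ∈ avail x}` (as a multiset of rewards labelled by agents). -/
structure MulState (d : ℕ) (ι : Type*) where
  hist : List (Act d × ℝ)
  avail : Act d → Finset ι
  val : Act d → ι → ℝ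

section Mul

variable {d : ℕ} {ι Ω : Type*} {X : Finset (Act d)} [MeasurableSpace Ω]

/-- The action that the single-agent algorithm requests next. -/
def MulState.next (S : SingleAlg d X Ω) (w : Ω) (s : MulState d ι) : Act d := S.act w s.hist

open Classical in
/-- One pass through the `while` loop: if the buffer of the requested action is non-empty, remove
a reward from it and append it to the simulated history; otherwise do nothing. -/
noncomputable def MulState.read (S : SingleAlg d X Ω) (ρ : RemovalRule d ι) (w : Ω)
    (s : MulState d ι) : MulState d ι :=
  let x := s.next S w
  if hB : (s.avail x).Nonempty then
    let b := ρ.pick s.hist x (s.avail x) hB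
    { hist := s.hist ++ [(x, s.val x b)]
      avail := Function.update s.avail x ((s.avail x).erase b)
      val := s.val }
  else s

/-- The total number of rewards in the buffers. -/
def MulState.size (X : Finset (Act d)) (s : MulState d ι) : ℕ := ∑ x ∈ X, (s.avail x).card

/-- The whole `while` loop. Every effective pass removes one reward, so `size` many passes are
enough (`MulState.drain_exit`). -/
noncomputable def MulState.drain (S : SingleAlg d X Ω) (ρ : RemovalRule d ι) (w : Ω)
    (s : MulState d ι) : MulState d ι :=
  (MulState.read S ρ w)^[s.size X] s

open Classical in
/-- One time-step: all agents have played the requested action, with outcomes `p`; the buffer of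
that action is filled with the rewards of all agents and then the `while` loop is run. -/
noncomputable def MulState.round [Fintype ι] (S : SingleAlg d X Ω) (ρ : RemovalRule d ι) (w : Ω)
    (s : MulState d ι) (p : ι → Act d × ℝ) : MulState d ι :=
  MulState.drain S ρ w
    { hist := s.hist
      avail := Function.update s.avail (s.next S w) Finset.univ
      val := Function.update s.val (s.next S w) fun b => (p b).2 }

/-- The meta-algorithm `Mul` built on the single-agent algorithm `S`: it starts with empty buffers
and an empty simulated history, and at each time-step every agent plays the requested action. -/
noncomputable def mul [Fintype ι] (S : SingleAlg d X Ω) (ρ : RemovalRule d ι) :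
    MultiAlg d ι Ω :=
  fun w H _ => (H.foldl (MulState.round S ρ w) ⟨[], fun _ => ∅, fun _ _ => 0⟩).next S w

theorem MulState.read_of_empty (S : SingleAlg d X Ω) (ρ : RemovalRule d ι) (w : Ω)
    (s : MulState d ι) (h : s.avail (s.next S w) = ∅) : s.read S ρ w = s := by
  simp [MulState.read, h]

theorem MulState.size_read (S : SingleAlg d X Ω) (ρ : RemovalRule d ι) (w : Ω)
    (s : MulState d ι) (h : (s.avail (s.next S w)).Nonempty) :
    (s.read S ρ w).size X < s.size X := by
  classical
  unfold MulState.size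
  apply Finset.sum_lt_sum
  · intro x _
    by_cases hx : x = s.next S w
    · subst hx
      simp only [MulState.read, h, dite_true, Function.update_self]
      exact Finset.card_le_card (Finset.erase_subset _ _)
    · simp [MulState.read, h, Function.update_of_ne hx]
  · refine ⟨s.next S w, S.act_mem w s.hist, ?_⟩
    simp only [MulState.read, h, dite_true, Function.update_self]
    exact Finset.card_erase_lt_of_mem (ρ.pick_mem _ _ _ _)

/-- When the loop ends, its guard is false: the buffer of the requested action is empty. -/
theorem MulState.drain_exit (S : SingleAlg d X Ω) (ρ : RemovalRule d ι) (w : Ω)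
    (s : MulState d ι) :
    (s.drain S ρ w).avail ((s.drain S ρ w).next S w) = ∅ := by
  suffices H : ∀ (n : ℕ) (s : MulState d ι), s.size X ≤ n →
      ((MulState.read S ρ w)^[n] s).avail (((MulState.read S ρ w)^[n] s).next S w) = ∅ from
    H _ s le_rfl
  intro n
  induction n with
  | zero =>
    intro s hs
    by_contra hne
    have := MulState.size_read S ρ w s (Finset.nonempty_iff_ne_empty.mpr hne)
    omega
  | succ n ih =>
    intro s hs
    rw [Function.iterate_succ_apply]
    by_cases h : (s.avail (s.next S w)).Nonempty
    · exact ih _ (by have := MulState.size_read S ρ w s h; omega)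
    · have h' := Finset.not_nonempty_iff_eq_empty.mp h
      have hfix := MulState.read_of_empty S ρ w s h'
      rw [hfix, Function.iterate_fixed hfix]
      exact h'

end Mul

/-! ## Assumption on the regret curve -/

/-- Discrete first derivative `R'(t,h)`. -/
noncomputable def discDeriv (R : ℕ → ℝ) (t h : ℕ) : ℝ := (R (t + h) - R t) / h

/-- Discrete second derivative `R''(t,g,h)`. -/
noncomputable def discDeriv2 (R : ℕ → ℝ) (t g h : ℕ) : ℝ :=
  (discDeriv R (t + g) h - discDeriv R t h) / g

/-- Strict concavity (with margins `υ t`) and logarithmic limitation (with constants `c, ε`) of the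
regret curve `R` on the times `1, …, N`. -/
structure RegretRate (R : ℕ → ℝ) (N : ℕ) (υ : ℕ → ℝ) (c ε : ℝ) : Prop where
  margin_pos : ∀ t, 1 ≤ t → t ≤ N → 0 < υ t
  strict_concave : ∀ t g h, 1 ≤ t → 1 ≤ g → 1 ≤ h → t + g + h ≤ N →
    discDeriv2 R t g h ≤ -υ t
  log_limit : ∀ t g h, 1 ≤ t → 1 ≤ g → 1 ≤ h → t + g + h ≤ N →
    -(c * (t : ℝ) ^ (-2 + ε)) ≤ discDeriv2 R t g h

/-- The largest expected regret that one play of an action in `X` can incur. -/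
noncomputable def maxGap {d : ℕ} (θ : Act d) (X : Finset (Act d)) : ℝ :=
  sSup ((fun x => inner ℝ θ x) '' (X : Set (Act d))) -
    sInf ((fun x => inner ℝ θ x) '' (X : Set (Act d)))

/-! ## Adaptive reading of i.i.d. variables -/

section Adaptive

variable {Ω E Z κ : Type*} [MeasurableSpace Ω] [MeasurableSpace E] [MeasurableSpace Z]

/-! The order in which buffered rewards are consumed does not matter in law. Each reward appended to
the simulated history carries a noise variable that was never read before, and which variable it is
depends only on the internal randomness and on variables already read. Given the past it is a fresh
sample, so after `j` removals the simulated history has the law of `j` steps of the single-agent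
algorithm (`AdaptiveReading.map_eq`, `adaptiveReading_bufRun`). To express this, the meta-algorithm
is compared with a machine `bufRun` that is indexed by removals instead of time-steps
(`BanditInstance.exists_matches_mulState`).

Pathwise, the `nT` plays of a coalition of size `n` are the simulated plays together with the plays
whose rewards still wait in a buffer. Each of the `K` buffers holds at most `n - 1` rewards, which
gives `|v(C) + R(nT)| ≤ (n - 1)KD` (`BanditInstance.abs_value_mul_add_le`).

Convexity is now a competition between concavity and this error. For coalitions of sizes `1 ≤ s < q`
the mixed difference of `R` with `t = sT`, `g = (q - s)T`, `h = T` is at most `-υ(q - s)T²`, while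
the four errors add up to at most `4|M|KD` (`isConvexGame_of_discDeriv2_le`). For `s = 0` the bound
on `R''` is not available at `t = 0`; starting at `t = 1` costs one extra step of regret, which is
affordable because `v(∅) = 0` and singletons have no error. -/

theorem measurable_fin_snoc {j : ℕ} :
    Measurable fun p : (Fin j → E) × E => (Fin.snoc p.1 p.2 : Fin (j + 1) → E) := by
  refine measurable_pi_lambda _ fun i => ?_
  induction i using Fin.lastCases with
  | last => simpa using measurable_snd
  | cast i =>
    simp only [Fin.snoc_castSucc]
    exact (measurable_pi_apply i).comp measurable_fst

/-- Resampling one coordinate does not change the law of an i.i.d. family. -/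
theorem measurePreserving_update_infinitePi [DecidableEq κ] (ν : Measure Z)
    [IsProbabilityMeasure ν] (k : κ) :
    MeasurePreserving (fun p : (κ → Z) × Z => Function.update p.1 k p.2)
      ((Measure.infinitePi fun _ : κ => ν).prod ν) (Measure.infinitePi fun _ : κ => ν) := by
  have hm : Measurable fun p : (κ → Z) × Z => Function.update p.1 k p.2 := by
    refine measurable_pi_lambda _ fun i => ?_
    by_cases h : i = k
    · subst h
      simpa using measurable_snd
    · simp only [Function.update_of_ne h]
      exact (measurable_pi_apply i).comp measurable_fst
  refine ⟨hm, Measure.eq_infinitePi _ fun s t ht => ?_⟩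
  have hs : MeasurableSet (Set.pi (s : Set κ) t) :=
    MeasurableSet.pi s.countable_toSet fun i _ => ht i
  have hs' : MeasurableSet (Set.pi ((s.erase k : Finset κ) : Set κ) t) :=
    MeasurableSet.pi (s.erase k).countable_toSet fun i _ => ht i
  rw [Measure.map_apply hm hs]
  -- The constraint on coordinate `k`, if there is one, falls on the fresh sample; the old
  -- coordinate `k` becomes free.
  have : (fun p : (κ → Z) × Z => Function.update p.1 k p.2) ⁻¹' (Set.pi (s : Set κ) t) =
      (Set.pi ((s.erase k : Finset κ) : Set κ) t) ×ˢ (if k ∈ s then t k else Set.univ) := by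
    ext ⟨η, z⟩
    simp only [Set.mem_preimage, Set.mem_pi, Finset.mem_coe, Set.mem_prod, Finset.mem_erase]
    constructor
    · intro h
      refine ⟨fun i hi => by simpa [Function.update_of_ne hi.1] using h i hi.2, ?_⟩
      split_ifs with hk
      · simpa using h k hk
      · trivial
    · rintro ⟨h1, h2⟩ i hi
      by_cases hik : i = k
      · subst hik
        simpa [hi] using h2
      · simpa [Function.update_of_ne hik] using h1 i ⟨hik, hi⟩
  rw [this, Measure.prod_prod, Measure.infinitePi_pi (fun _ : κ => ν) fun i _ => ht i]
  split_ifs with hk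
  · rw [Finset.prod_erase_mul s _ hk]
  · simp [Finset.erase_eq_of_notMem hk]

/-- The law of the initial randomness and the first `j` entries of a history, each new entry being
`G` applied to the past and a fresh sample of `ν`. -/
noncomputable def adaptiveLaw (P : Measure Ω) (ν : Measure Z)
    (G : ∀ j, Ω → (Fin j → E) → Z → E) : ∀ j, Measure (Ω × (Fin j → E))
  | 0 => P.map fun w => (w, Fin.elim0)
  | j + 1 => ((adaptiveLaw P ν G j).prod ν).map
      fun p => (p.1.1, Fin.snoc p.1.2 (G j p.1.1 p.1.2 p.2))

/-- A history whose entry number `j` reads the coordinate `idx j` of the family `η`, where the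
choice of the coordinate and the past do not depend on the value of that coordinate. -/
structure AdaptiveReading [DecidableEq κ] (G : ∀ j, Ω → (Fin j → E) → Z → E)
    (H : ∀ j, Ω × (κ → Z) → (Fin j → E)) (idx : ℕ → Ω × (κ → Z) → κ) : Prop where
  measurable_hist : ∀ j, Measurable (H j)
  measurable_idx : ∀ j k, MeasurableSet {p | idx j p = k}
  step : ∀ j p, H (j + 1) p = Fin.snoc (H j p) (G j p.1 (H j p) (p.2 (idx j p)))
  hist_update : ∀ j w η z, H j (w, Function.update η (idx j (w, η)) z) = H j (w, η)
  idx_update : ∀ j w η z, idx j (w, Function.update η (idx j (w, η)) z) = idx j (w, η)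

/-- Split according to the value `k` of the index. On each piece the past is insensitive to
coordinate `k`, so resampling that coordinate, which preserves the law of the family, turns the
reading into a fresh draw. The right-hand side does not mention `idx`: any two adaptive readings of
the same `G` give the same law. -/
theorem AdaptiveReading.map_eq [DecidableEq κ] [Countable κ] {P : Measure Ω}
    [IsProbabilityMeasure P] {ν : Measure Z} [IsProbabilityMeasure ν]
    {G : ∀ j, Ω → (Fin j → E) → Z → E}
    (hG : ∀ j, Measurable fun p : (Ω × (Fin j → E)) × Z => G j p.1.1 p.1.2 p.2)
    {H : ∀ j, Ω × (κ → Z) → (Fin j → E)} {idx : ℕ → Ω × (κ → Z) → κ}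
    (h : AdaptiveReading G H idx) (j : ℕ) :
    (P.prod (Measure.infinitePi fun _ : κ => ν)).map (fun p => (p.1, H j p)) =
      adaptiveLaw P ν G j := by
  induction j with
  | zero =>
    have h0 : (fun p : Ω × (κ → Z) => (p.1, H 0 p)) =
        (fun w : Ω => (w, (Fin.elim0 : Fin 0 → E))) ∘ Prod.fst := by
      funext p
      exact Prod.ext rfl (Subsingleton.elim _ _)
    rw [h0, ← Measure.map_map (by fun_prop) measurable_fst, Measure.map_fst_prod]
    simp [adaptiveLaw]
  | succ j ih =>
    set μ := Measure.infinitePi fun _ : κ => ν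
    have hg : Measurable fun p : (Ω × (Fin j → E)) × Z =>
        ((p.1.1, Fin.snoc p.1.2 (G j p.1.1 p.1.2 p.2)) : Ω × (Fin (j + 1) → E)) :=
      (measurable_fst.comp measurable_fst).prodMk
        (measurable_fin_snoc.comp ((measurable_snd.comp measurable_fst).prodMk (hG j)))
    set g := fun p : (Ω × (Fin j → E)) × Z =>
        ((p.1.1, Fin.snoc p.1.2 (G j p.1.1 p.1.2 p.2)) : Ω × (Fin (j + 1) → E)) with hgdef
    have hHj : Measurable fun p : Ω × (κ → Z) => (p.1, H j p) :=
      measurable_fst.prodMk (h.measurable_hist j)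
    have hHz : Measurable fun q : (Ω × (κ → Z)) × Z => ((q.1.1, H j q.1), q.2) :=
      (hHj.comp measurable_fst).prodMk measurable_snd
    have hR : adaptiveLaw P ν G (j + 1) = ((P.prod μ).prod ν).map
        fun q : (Ω × (κ → Z)) × Z => g ((q.1.1, H j q.1), q.2) := by
      have : (fun q : (Ω × (κ → Z)) × Z => g ((q.1.1, H j q.1), q.2)) =
        g ∘ Prod.map (fun p : Ω × (κ → Z) => (p.1, H j p)) id := rfl
      rw [this, ← Measure.map_map hg (hHj.prodMap measurable_id),
        ← Measure.map_prod_map _ _ hHj measurable_id, ih, Measure.map_id]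
      rfl
    rw [hR]
    ext B hB
    rw [Measure.map_apply (measurable_fst.prodMk (h.measurable_hist _)) hB,
      Measure.map_apply (show Measurable fun q : (Ω × (κ → Z)) × Z =>
        g ((q.1.1, H j q.1), q.2) from hg.comp hHz) hB]
    have e1 : (fun p : Ω × (κ → Z) => (p.1, H (j + 1) p)) ⁻¹' B =
        ⋃ k, {p | idx j p = k ∧ g ((p.1, H j p), p.2 k) ∈ B} := by
      ext p
      simp [h.step, hgdef]
    have e2 : (fun q : (Ω × (κ → Z)) × Z => g ((q.1.1, H j q.1), q.2)) ⁻¹' B =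
        ⋃ k, {q | idx j q.1 = k ∧ g ((q.1.1, H j q.1), q.2) ∈ B} := by
      ext p
      simp
    have m1 : ∀ k, MeasurableSet {p : Ω × (κ → Z) | idx j p = k ∧ g ((p.1, H j p), p.2 k) ∈ B} :=
      fun k => (h.measurable_idx j k).inter (hB.preimage (hg.comp
        (hHj.prodMk ((measurable_pi_apply k).comp measurable_snd))))
    have m2 : ∀ k, MeasurableSet
        {q : (Ω × (κ → Z)) × Z | idx j q.1 = k ∧ g ((q.1.1, H j q.1), q.2) ∈ B} :=
      fun k => ((h.measurable_idx j k).preimage measurable_fst).inter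
        (hB.preimage (hg.comp hHz))
    have hd1 : Pairwise (Function.onFun Disjoint
        fun k => {p : Ω × (κ → Z) | idx j p = k ∧ g ((p.1, H j p), p.2 k) ∈ B}) := by
      intro k k' hk
      refine Set.disjoint_left.mpr fun p hp hp' => hk (hp.1.symm.trans hp'.1)
    have hd2 : Pairwise (Function.onFun Disjoint
        fun k => {q : (Ω × (κ → Z)) × Z | idx j q.1 = k ∧ g ((q.1.1, H j q.1), q.2) ∈ B}) := by
      intro k k' hk
      refine Set.disjoint_left.mpr fun p hp hp' => hk (hp.1.symm.trans hp'.1)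
    rw [e1, e2, measure_iUnion hd1 m1, measure_iUnion hd2 m2]
    refine tsum_congr fun k => ?_
    have mp : MeasurePreserving (fun q : (Ω × (κ → Z)) × Z =>
        (q.1.1, Function.update q.1.2 k q.2)) ((P.prod μ).prod ν) (P.prod μ) :=
      ((MeasurePreserving.id P).prod (measurePreserving_update_infinitePi ν k)).comp
        (measurePreserving_prodAssoc P μ ν)
    rw [← mp.measure_preimage (m1 k).nullMeasurableSet]
    congr 1
    ext ⟨⟨w, η⟩, z⟩
    simp only [Set.mem_preimage, Set.mem_ofPred_eq, Function.update_self]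
    constructor
    · rintro ⟨hi, hb⟩
      -- Writing the old value `η k` back into the updated family recovers `η`, so invariance also
      -- holds in this direction.
      have hη := h.idx_update j w (Function.update η k z) (η k)
      have hη' := h.hist_update j w (Function.update η k z) (η k)
      rw [hi] at hη hη'
      simp only [Function.update_idem, Function.update_eq_self] at hη hη'
      exact ⟨hη, by rw [hη']; exact hb⟩
    · rintro ⟨hi, hb⟩
      have hη := h.idx_update j w η z
      have hη' := h.hist_update j w η z
      rw [hi] at hη hη'
      exact ⟨hη, by rw [hη']; exact hb⟩

end Adaptive

/-! ## Reading rewards on demand -/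

section Machine

variable {d : ℕ} {ι Ω : Type*} {X : Finset (Act d)} [MeasurableSpace Ω]

/-- The buffers without the rewards: `avail x` are the agents whose latest reward for `x` is
unread, `stamp x` is the time-step at which `B_x` was last filled and `time` is the number of
time-steps used so far. -/
@[ext]
structure BufState (X : Finset (Act d)) (ι : Type*) where
  avail : X → Finset ι
  stamp : X → ℕ
  time : ℕ

/-- Leaving out the rewards makes the state discrete, so measurability can be checked on countably
many pieces. -/
instance BufState.instCountable [Finite ι] : Countable (BufState X ι) := by
  have : Function.Injective fun D : BufState X ι => (D.avail, D.stamp, D.time) := by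
    intro D D' h
    simp only [Prod.mk.injEq] at h
    exact BufState.ext h.1 h.2.1 h.2.2
  exact this.countable

open Classical in
/-- Use one time-step to fill the buffer of `x` if it is empty. -/
noncomputable def BufState.refill [Fintype ι] (D : BufState X ι) (x : X) : BufState X ι :=
  if (D.avail x).Nonempty then D
  else ⟨Function.update D.avail x Finset.univ, Function.update D.stamp x D.time, D.time + 1⟩

open Classical in
/-- Remove the reward of agent `b` from the buffer of `x`. -/
noncomputable def BufState.take (D : BufState X ι) (x : X) (b : ι) : BufState X ι :=
  { D with avail := Function.update D.avail x ((D.avail x).erase b) }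

/-- The noise variable `k` does not belong to a reward that has been removed. -/
def BufState.Unread (D : BufState X ι) (k : ι × ℕ) : Prop :=
  D.time ≤ k.2 ∨ ∃ x, k.1 ∈ D.avail x ∧ D.stamp x = k.2

/-- The non-empty buffers were filled at different time-steps in the past. -/
def BufState.Valid (D : BufState X ι) : Prop :=
  (∀ x, (D.avail x).Nonempty → D.stamp x < D.time) ∧
    ∀ x x', (D.avail x).Nonempty → (D.avail x').Nonempty → D.stamp x = D.stamp x' → x = x'

theorem BufState.refill_of_nonempty [Fintype ι] {D : BufState X ι} {x : X}
    (h : (D.avail x).Nonempty) : D.refill x = D := by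
  simp [BufState.refill, h]

theorem BufState.refill_nonempty [Fintype ι] [Nonempty ι] (D : BufState X ι) (x : X) :
    ((D.refill x).avail x).Nonempty := by
  by_cases h : (D.avail x).Nonempty
  · rwa [BufState.refill_of_nonempty h]
  · simp [BufState.refill, h]

theorem BufState.Valid.refill [Fintype ι] {D : BufState X ι} (hD : D.Valid) (x : X) :
    (D.refill x).Valid := by
  by_cases h : (D.avail x).Nonempty
  · rwa [BufState.refill_of_nonempty h]
  · simp only [BufState.refill, h, if_false]
    refine ⟨fun y hy => ?_, fun y y' hy hy' hyy => ?_⟩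
    · by_cases hyx : y = x
      · subst hyx
        simp
      · simp only [ne_eq, hyx, not_false_eq_true, Function.update_of_ne] at hy ⊢
        exact (hD.1 y hy).trans (Nat.lt_succ_self _)
    · by_cases h1 : y = x <;> by_cases h2 : y' = x
      · rw [h1, h2]
      · subst h1
        simp only [Function.update_self, ne_eq, h2, not_false_eq_true, Function.update_of_ne]
          at hyy hy'
        exact absurd (hD.1 y' hy') (by omega)
      · subst h2
        simp only [Function.update_self, ne_eq, h1, not_false_eq_true, Function.update_of_ne]
          at hyy hy
        exact absurd (hD.1 y hy) (by omega)
      · simp only [ne_eq, h1, h2, not_false_eq_true, Function.update_of_ne] at hyy hy hy'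
        exact hD.2 y y' hy hy' hyy

theorem BufState.Unread.of_refill [Fintype ι] {D : BufState X ι} {x : X} {k : ι × ℕ}
    (hk : (D.refill x).Unread k) : D.Unread k := by
  by_cases h : (D.avail x).Nonempty
  · rwa [BufState.refill_of_nonempty h] at hk
  · simp only [BufState.refill, h, if_false] at hk
    rcases hk with hk | ⟨y, hy, hyk⟩
    · exact Or.inl ((Nat.le_succ _).trans hk)
    · by_cases hyx : y = x
      · subst hyx
        simp only [Function.update_self] at hyk
        exact Or.inl hyk.le
      · simp only [ne_eq, hyx, not_false_eq_true, Function.update_of_ne] at hy hyk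
        exact Or.inr ⟨y, hy, hyk⟩

theorem BufState.time_le_refill [Fintype ι] (D : BufState X ι) (x : X) : D.time ≤ (D.refill x).time := by
  unfold BufState.refill
  split_ifs <;> simp

theorem BufState.take_avail_subset (D : BufState X ι) (x y : X) (b : ι) :
    (D.take x b).avail y ⊆ D.avail y := by
  classical
  by_cases hyx : y = x
  · subst hyx
    simpa [BufState.take] using Finset.erase_subset _ _
  · simp [BufState.take, hyx]

theorem BufState.Valid.take {D : BufState X ι} (hD : D.Valid) (x : X) (b : ι) :
    (D.take x b).Valid :=
  ⟨fun y hy => hD.1 y (hy.mono (D.take_avail_subset x y b)),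
    fun y y' hy hy' h => hD.2 y y' (hy.mono (D.take_avail_subset x y b))
      (hy'.mono (D.take_avail_subset x y' b)) h⟩

/-- Validity excludes a second copy of the removed variable: its stamp lies in the past, and no
other non-empty buffer has the same stamp. -/
theorem BufState.Unread.of_take {D : BufState X ι} (hD : D.Valid) {x : X} {b : ι}
    (hb : b ∈ D.avail x) {k : ι × ℕ} (hk : (D.take x b).Unread k) :
    D.Unread k ∧ k ≠ (b, D.stamp x) := by
  rcases hk with hk | ⟨y, hy, hyk⟩
  · refine ⟨Or.inl hk, fun h => ?_⟩
    have h1 := hD.1 x ⟨b, hb⟩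
    have h2 : D.time ≤ k.2 := hk
    rw [h] at h2
    exact absurd h1 (not_lt.mpr h2)
  · have hy' := D.take_avail_subset x y b hy
    refine ⟨Or.inr ⟨y, hy', hyk⟩, fun h => ?_⟩
    subst h
    have : y = x := hD.2 y x ⟨_, hy'⟩ ⟨b, hb⟩ hyk
    subst this
    simp [BufState.take] at hy

/-- The action requested by the single-agent algorithm. -/
def SingleAlg.request (S : SingleAlg d X Ω) (w : Ω) (h : List (Act d × ℝ)) : X :=
  ⟨S.act w h, S.act_mem w h⟩

variable [Fintype ι] [Nonempty ι]

/-- The agent whose reward for `x` is removed next. -/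
noncomputable def BufState.label (ρ : RemovalRule d ι) (D : BufState X ι)
    (h : List (Act d × ℝ)) (x : X) : ι :=
  ρ.pick h x ((D.refill x).avail x) (D.refill_nonempty x)

theorem BufState.label_mem (ρ : RemovalRule d ι) (D : BufState X ι)
    (h : List (Act d × ℝ)) (x : X) : D.label ρ h x ∈ (D.refill x).avail x :=
  ρ.pick_mem _ _ _ _

/-- The noise variable that is read next. -/
noncomputable def BufState.readIdx (S : SingleAlg d X Ω) (ρ : RemovalRule d ι) (w : Ω)
    (D : BufState X ι) (h : List (Act d × ℝ)) : ι × ℕ :=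
  (D.label ρ h (S.request w h), (D.refill (S.request w h)).stamp (S.request w h))

/-- The buffers after the next reward has been removed. -/
noncomputable def BufState.advance (S : SingleAlg d X Ω) (ρ : RemovalRule d ι) (w : Ω)
    (D : BufState X ι) (h : List (Act d × ℝ)) : BufState X ι :=
  (D.refill (S.request w h)).take (S.request w h) (D.label ρ h (S.request w h))

theorem BufState.Valid.advance {S : SingleAlg d X Ω} {ρ : RemovalRule d ι} {w : Ω}
    {D : BufState X ι} (hD : D.Valid) (h : List (Act d × ℝ)) : (D.advance S ρ w h).Valid :=
  (hD.refill _).take _ _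

theorem BufState.unread_readIdx {S : SingleAlg d X Ω} {ρ : RemovalRule d ι} {w : Ω}
    {D : BufState X ι} (h : List (Act d × ℝ)) :
    D.Unread (D.readIdx S ρ w h) :=
  BufState.Unread.of_refill (x := S.request w h) (Or.inr ⟨_, D.label_mem ρ h _, rfl⟩)

theorem BufState.Unread.of_advance {S : SingleAlg d X Ω} {ρ : RemovalRule d ι} {w : Ω}
    {D : BufState X ι} (hD : D.Valid) {h : List (Act d × ℝ)} {k : ι × ℕ}
    (hk : (D.advance S ρ w h).Unread k) : D.Unread k ∧ k ≠ D.readIdx S ρ w h :=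
  have := BufState.Unread.of_take (hD.refill _) (D.label_mem ρ h _) hk
  ⟨this.1.of_refill, this.2⟩

/-- The action-reward pair obtained by playing the requested action under noise `z`. -/
noncomputable def SingleAlg.outcome (S : SingleAlg d X Ω) (θ : Act d) (j : ℕ) (w : Ω)
    (h : Fin j → Act d × ℝ) (z : ℝ) : Act d × ℝ :=
  (S.act w (List.ofFn h), inner ℝ θ (S.act w (List.ofFn h)) + z)

/-- The buffers and the simulated history after `j` rewards have been removed. -/
noncomputable def bufRun (θ : Act d) (S : SingleAlg d X Ω) (ρ : RemovalRule d ι) :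
    ∀ j, Ω × (ι × ℕ → ℝ) → BufState X ι × (Fin j → Act d × ℝ)
  | 0, _ => (⟨fun _ => ∅, fun _ => 0, 0⟩, Fin.elim0)
  | j + 1, p =>
    ((bufRun θ S ρ j p).1.advance S ρ p.1 (List.ofFn (bufRun θ S ρ j p).2),
      Fin.snoc (bufRun θ S ρ j p).2 (S.outcome θ j p.1 (bufRun θ S ρ j p).2
        (p.2 ((bufRun θ S ρ j p).1.readIdx S ρ p.1 (List.ofFn (bufRun θ S ρ j p).2)))))

theorem valid_bufRun (θ : Act d) (S : SingleAlg d X Ω) (ρ : RemovalRule d ι) (j : ℕ)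
    (p : Ω × (ι × ℕ → ℝ)) : (bufRun θ S ρ j p).1.Valid := by
  induction j with
  | zero => exact ⟨fun x hx => by simp [bufRun] at hx, fun x x' hx => by simp [bufRun] at hx⟩
  | succ j ih => exact ih.advance _

open Classical in
-- A variable unread after `j + 1` removals was unread before the last one and is not the one
-- removed then, so no step so far has consulted it.
theorem bufRun_update (θ : Act d) (S : SingleAlg d X Ω) (ρ : RemovalRule d ι) (j : ℕ)
    (w : Ω) (η : ι × ℕ → ℝ) (z : ℝ) {k : ι × ℕ} (hk : (bufRun θ S ρ j (w, η)).1.Unread k) :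
    bufRun θ S ρ j (w, Function.update η k z) = bufRun θ S ρ j (w, η) := by
  induction j with
  | zero => rfl
  | succ j ih =>
    obtain ⟨h1, h2⟩ := BufState.Unread.of_advance (valid_bufRun θ S ρ j (w, η)) hk
    simp only [bufRun, ih h1, Function.update_of_ne h2.symm]

/-! ### Measurability of the on-demand run -/

theorem SingleAlg.measurable_outcome (S : SingleAlg d X Ω) (θ : Act d) (j : ℕ) :
    Measurable fun p : (Ω × (Fin j → Act d × ℝ)) × ℝ => S.outcome θ j p.1.1 p.1.2 p.2 := by
  have h := (S.measurable_act j).comp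
    (measurable_fst : Measurable fun p : (Ω × (Fin j → Act d × ℝ)) × ℝ => p.1)
  refine h.prodMk ((Measurable.add ?_ measurable_snd))
  exact (measurable_const.inner measurable_id).comp h

/-- A map that is measurable on each of countably many measurable pieces is measurable. -/
theorem measurable_of_countable_pieces {α β γ : Type*} [MeasurableSpace α] [MeasurableSpace β]
    [Countable γ] {f : α → β} (c : α → γ) (hc : ∀ k, MeasurableSet {a | c a = k})
    (g : γ → α → β) (hg : ∀ k, Measurable (g k)) (hfg : ∀ a, f a = g (c a) a) :
    Measurable f := by
  intro B hB
  have : f ⁻¹' B = ⋃ k, {a | c a = k} ∩ (g k) ⁻¹' B := by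
    ext a
    simp [hfg]
  rw [this]
  exact MeasurableSet.iUnion fun k => (hc k).inter (hg k hB)

theorem measurableSet_comp_eq {α γ δ : Type*} [MeasurableSpace α] [Countable γ]
    (c : α → γ) (hc : ∀ k, MeasurableSet {a | c a = k}) (F : γ → δ) (y : δ) :
    MeasurableSet {a | F (c a) = y} := by
  have : {a | F (c a) = y} = ⋃ k : {k // F k = y}, {a | c a = k} := by
    ext a
    simp
  rw [this]
  exact MeasurableSet.iUnion fun k => hc k

/-- The buffers, the requested action and the label of the reward to be read in step `j`. -/
noncomputable def bufCode (θ : Act d) (S : SingleAlg d X Ω) (ρ : RemovalRule d ι) (j : ℕ)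
    (p : Ω × (ι × ℕ → ℝ)) : BufState X ι × X × ι :=
  ((bufRun θ S ρ j p).1, S.request p.1 (List.ofFn (bufRun θ S ρ j p).2),
    (bufRun θ S ρ j p).1.label ρ (List.ofFn (bufRun θ S ρ j p).2)
      (S.request p.1 (List.ofFn (bufRun θ S ρ j p).2)))

theorem measurableSet_bufCode (θ : Act d) (S : SingleAlg d X Ω) (ρ : RemovalRule d ι) (j : ℕ)
    (hD : ∀ D, MeasurableSet {p | (bufRun θ S ρ j p).1 = D})
    (hH : Measurable fun p => (bufRun θ S ρ j p).2) (c : BufState X ι × X × ι) :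
    MeasurableSet {p | bufCode θ S ρ j p = c} := by
  obtain ⟨D, x, b⟩ := c
  have h1 : MeasurableSet {p : Ω × (ι × ℕ → ℝ) |
      S.act p.1 (List.ofFn (bufRun θ S ρ j p).2) = (x : Act d)} :=
    (measurableSet_singleton (x : Act d)).preimage
      ((S.measurable_act j).comp (measurable_fst.prodMk hH))
  have h2 := (ρ.measurable_pick j x _ (D.refill_nonempty x) b).preimage hH
  convert ((hD D).inter h1).inter h2 using 1
  ext p
  simp only [bufCode, Prod.mk.injEq, Set.mem_ofPred_eq, Set.mem_inter_iff, Set.mem_preimage,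
    BufState.label, SingleAlg.request, Subtype.ext_iff, and_assoc]
  constructor
  · rintro ⟨rfl, hx, hb⟩
    obtain ⟨x, hxX⟩ := x
    dsimp only at hx
    subst hx
    exact ⟨rfl, rfl, hb⟩
  · rintro ⟨rfl, hx, hb⟩
    obtain ⟨x, hxX⟩ := x
    dsimp only at hx
    subst hx
    exact ⟨rfl, rfl, hb⟩

theorem measurable_bufRun (θ : Act d) (S : SingleAlg d X Ω) (ρ : RemovalRule d ι) (j : ℕ) :
    (∀ D, MeasurableSet {p | (bufRun θ S ρ j p).1 = D}) ∧
      Measurable fun p => (bufRun θ S ρ j p).2 := by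
  induction j with
  | zero =>
    refine ⟨fun D => MeasurableSet.const (_ = D), measurable_const⟩
  | succ j ih =>
    have hc := measurableSet_bufCode θ S ρ j ih.1 ih.2
    refine ⟨fun D => measurableSet_comp_eq (bufCode θ S ρ j) hc
      (fun c => (c.1.refill c.2.1).take c.2.1 c.2.2) D, ?_⟩
    refine measurable_fin_snoc.comp (ih.2.prodMk ((S.measurable_outcome θ j).comp
      ((measurable_fst.prodMk ih.2).prodMk ?_)))
    exact measurable_of_countable_pieces (bufCode θ S ρ j) hc
      (fun c p => p.2 (c.2.2, (c.1.refill c.2.1).stamp c.2.1))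
      (fun c => (measurable_pi_apply _).comp measurable_snd) fun p => rfl

open Classical in
-- The variable about to be read is still unread, so `bufRun_update` applies to it. This is where
-- the ban on looking into the buffers enters.
theorem adaptiveReading_bufRun (θ : Act d) (S : SingleAlg d X Ω) (ρ : RemovalRule d ι) :
    AdaptiveReading (S.outcome θ) (fun j p => (bufRun θ S ρ j p).2)
      (fun j p => (bufRun θ S ρ j p).1.readIdx S ρ p.1 (List.ofFn (bufRun θ S ρ j p).2)) where
  measurable_hist j := (measurable_bufRun θ S ρ j).2
  measurable_idx j k := by
    have ih := measurable_bufRun θ S ρ j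
    exact measurableSet_comp_eq (bufCode θ S ρ j) (measurableSet_bufCode θ S ρ j ih.1 ih.2)
      (fun c => (c.2.2, (c.1.refill c.2.1).stamp c.2.1)) k
  step j p := rfl
  hist_update j w η z := by
    rw [bufRun_update θ S ρ j w η z (BufState.unread_readIdx _)]
  idx_update j w η z := by
    dsimp only
    rw [bufRun_update θ S ρ j w η z (BufState.unread_readIdx _)]

end Machine

/-! ## The meta-algorithm reads rewards on demand -/

section Link

variable {d : ℕ} {ι Ω : Type*} {X : Finset (Act d)} [MeasurableSpace Ω]

theorem MulState.read_avail_subset (S : SingleAlg d X Ω) (ρ : RemovalRule d ι) (w : Ω)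
    (s : MulState d ι) (x : Act d) : (s.read S ρ w).avail x ⊆ s.avail x := by
  classical
  by_cases h : (s.avail (s.next S w)).Nonempty
  · by_cases hx : x = s.next S w
    · subst hx
      simpa [MulState.read, h] using Finset.erase_subset _ _
    · simp [MulState.read, h, hx]
  · rw [MulState.read_of_empty S ρ w s (Finset.not_nonempty_iff_eq_empty.mp h)]

/-- The total weight of all rewards in the simulated history and in the buffers. -/
noncomputable def MulState.weight (X : Finset (Act d)) (g : Act d → ℝ) (s : MulState d ι) : ℝ :=
  (s.hist.map fun q => g q.1).sum + ∑ x ∈ X, ((s.avail x).card : ℝ) * g x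

/-- A pass only moves one play from a buffer to the history. The weight `g` is general because two
choices are needed: the regret gap, and the constant `1`, which counts plays. -/
theorem MulState.weight_read (g : Act d → ℝ) (S : SingleAlg d X Ω) (ρ : RemovalRule d ι) (w : Ω)
    (s : MulState d ι) : (s.read S ρ w).weight X g = s.weight X g := by
  classical
  by_cases h : (s.avail (s.next S w)).Nonempty
  · have hX : s.next S w ∈ X := S.act_mem w s.hist
    have hc := Finset.card_erase_add_one (ρ.pick_mem s.hist (s.next S w) _ h)
    simp only [MulState.weight, MulState.read, h, dite_true, List.map_append, List.sum_append,
      List.map_cons, List.map_nil, List.sum_singleton]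
    rw [← Finset.add_sum_erase X _ hX, ← Finset.add_sum_erase X _ hX, Function.update_self,
      ← hc]
    have : ∑ x ∈ X.erase (s.next S w), ((Function.update s.avail (s.next S w)
        ((s.avail (s.next S w)).erase (ρ.pick s.hist (s.next S w) _ h)) x).card : ℝ) * g x =
        ∑ x ∈ X.erase (s.next S w), ((s.avail x).card : ℝ) * g x :=
      Finset.sum_congr rfl fun x hx => by rw [Function.update_of_ne (Finset.ne_of_mem_erase hx)]
    rw [this]
    push_cast
    ring
  · rw [MulState.read_of_empty S ρ w s (Finset.not_nonempty_iff_eq_empty.mp h)]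

theorem MulState.iterate_read_avail_subset (S : SingleAlg d X Ω) (ρ : RemovalRule d ι) (w : Ω)
    (m : ℕ) (s : MulState d ι) (x : Act d) :
    ((MulState.read S ρ w)^[m] s).avail x ⊆ s.avail x := by
  induction m generalizing s with
  | zero => simp
  | succ m ih =>
    rw [Function.iterate_succ_apply]
    exact (ih _).trans (s.read_avail_subset S ρ w x)

theorem MulState.weight_drain (g : Act d → ℝ) (S : SingleAlg d X Ω) (ρ : RemovalRule d ι) (w : Ω)
    (s : MulState d ι) : (s.drain S ρ w).weight X g = s.weight X g := by
  suffices H : ∀ (m : ℕ) (s : MulState d ι),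
      ((MulState.read S ρ w)^[m] s).weight X g = s.weight X g from H _ s
  intro m
  induction m with
  | zero => simp
  | succ m ih =>
    intro s
    rw [Function.iterate_succ_apply, ih, MulState.weight_read]

variable [Fintype ι]

/-- The state of the meta-algorithm after `t` time-steps. -/
noncomputable def BanditInstance.mulState (J : BanditInstance d ι) (S : SingleAlg d X Ω)
    (ρ : RemovalRule d ι) (p : Ω × (ι × ℕ → ℝ)) (t : ℕ) : MulState d ι :=
  (J.history (mul S ρ) p.1 p.2 t).foldl (MulState.round S ρ p.1) ⟨[], fun _ => ∅, fun _ _ => 0⟩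

/-- The action that all agents play at time-step `t + 1`. -/
noncomputable def BanditInstance.mulAct (J : BanditInstance d ι) (S : SingleAlg d X Ω)
    (ρ : RemovalRule d ι) (p : Ω × (ι × ℕ → ℝ)) (t : ℕ) : Act d :=
  (J.mulState S ρ p t).next S p.1

theorem BanditInstance.mulState_succ (J : BanditInstance d ι) (S : SingleAlg d X Ω)
    (ρ : RemovalRule d ι) (p : Ω × (ι × ℕ → ℝ)) (t : ℕ) :
    J.mulState S ρ p (t + 1) = MulState.round S ρ p.1 (J.mulState S ρ p t)
      fun a => (J.mulAct S ρ p t, inner ℝ J.theta (J.mulAct S ρ p t) + p.2 (a, t)) := by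
  simp only [BanditInstance.mulState, BanditInstance.history, List.foldl_append, List.foldl_cons,
    List.foldl_nil]
  rfl

open Classical in
/-- The state in which the loop is entered after everybody has played the requested action. -/
noncomputable def MulState.fill (S : SingleAlg d X Ω) (w : Ω) (s : MulState d ι)
    (p : ι → Act d × ℝ) : MulState d ι :=
  { hist := s.hist
    avail := Function.update s.avail (s.next S w) Finset.univ
    val := Function.update s.val (s.next S w) fun b => (p b).2 }

theorem MulState.round_eq (S : SingleAlg d X Ω) (ρ : RemovalRule d ι) (w : Ω)
    (s : MulState d ι) (p : ι → Act d × ℝ) :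
    s.round S ρ w p = (s.fill S w p).drain S ρ w := rfl

theorem MulState.weight_fill (g : Act d → ℝ) (S : SingleAlg d X Ω) (w : Ω)
    (s : MulState d ι) (p : ι → Act d × ℝ) (h : s.avail (s.next S w) = ∅) :
    (s.fill S w p).weight X g = s.weight X g + Fintype.card ι * g (s.next S w) := by
  classical
  have hX : s.next S w ∈ X := S.act_mem w s.hist
  simp only [MulState.weight, MulState.fill]
  rw [← Finset.add_sum_erase X _ hX, ← Finset.add_sum_erase X (fun x => (_ : ℝ) * g x) hX,
    Function.update_self, h]
  have : ∑ x ∈ X.erase (s.next S w), ((Function.update s.avail (s.next S w)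
        Finset.univ x).card : ℝ) * g x =
        ∑ x ∈ X.erase (s.next S w), ((s.avail x).card : ℝ) * g x :=
    Finset.sum_congr rfl fun x hx => by rw [Function.update_of_ne (Finset.ne_of_mem_erase hx)]
  rw [this]
  simp
  ring

theorem BanditInstance.mulState_avail_next (J : BanditInstance d ι) (S : SingleAlg d X Ω)
    (ρ : RemovalRule d ι) (p : Ω × (ι × ℕ → ℝ)) (t : ℕ) :
    (J.mulState S ρ p t).avail (J.mulAct S ρ p t) = ∅ := by
  cases t with
  | zero => rfl
  | succ t =>
    rw [BanditInstance.mulAct, BanditInstance.mulState_succ]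
    exact MulState.drain_exit S ρ p.1 _

theorem BanditInstance.weight_mulState (J : BanditInstance d ι) (g : Act d → ℝ)
    (S : SingleAlg d X Ω) (ρ : RemovalRule d ι) (p : Ω × (ι × ℕ → ℝ)) (t : ℕ) :
    (J.mulState S ρ p t).weight X g =
      Fintype.card ι * ∑ s ∈ Finset.range t, g (J.mulAct S ρ p s) := by
  induction t with
  | zero => simp [BanditInstance.mulState, BanditInstance.history, MulState.weight]
  | succ t ih =>
    rw [J.mulState_succ, MulState.round_eq, MulState.weight_drain,
      MulState.weight_fill g S p.1 _ _ (J.mulState_avail_next S ρ p t), ih, Finset.sum_range_succ,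
      mul_add]
    rfl

theorem MulState.size_fill_pos [Nonempty ι] (S : SingleAlg d X Ω) (w : Ω)
    (s : MulState d ι) (p : ι → Act d × ℝ) : 0 < (s.fill S w p).size X := by
  classical
  refine Finset.sum_pos' (fun _ _ => Nat.zero_le _) ⟨s.next S w, S.act_mem w s.hist, ?_⟩
  simpa [MulState.fill] using Fintype.card_pos

/-- The buffer just filled is the one being requested, so the first pass of the loop removes a
reward from it at once. The strict inequality is what makes the error of a singleton coalition
vanish. -/
theorem BanditInstance.card_avail_mulState_lt [Nonempty ι] (J : BanditInstance d ι)
    (S : SingleAlg d X Ω) (ρ : RemovalRule d ι) (p : Ω × (ι × ℕ → ℝ)) (t : ℕ) (x : Act d) :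
    ((J.mulState S ρ p t).avail x).card < Fintype.card ι := by
  classical
  induction t generalizing x with
  | zero => simpa [BanditInstance.mulState, BanditInstance.history] using Fintype.card_pos
  | succ t ih =>
    rw [J.mulState_succ, MulState.round_eq]
    set q := fun a => (J.mulAct S ρ p t, inner ℝ J.theta (J.mulAct S ρ p t) + p.2 (a, t))
    set s := J.mulState S ρ p t
    obtain ⟨m, hm⟩ := Nat.exists_eq_succ_of_ne_zero (s.size_fill_pos S p.1 q).ne'
    rw [MulState.drain, hm, Function.iterate_succ_apply]
    refine (Finset.card_le_card (MulState.iterate_read_avail_subset S ρ p.1 m _ x)).trans_lt ?_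
    by_cases hx : x = s.next S p.1
    · have hn : (s.fill S p.1 q).next S p.1 = s.next S p.1 := rfl
      have hne : ((s.fill S p.1 q).avail ((s.fill S p.1 q).next S p.1)).Nonempty := by
        rw [hn]
        simp [MulState.fill]
      subst hx
      simp only [MulState.read, hne, dite_true]
      rw [← hn, Function.update_self]
      exact (Finset.card_erase_lt_of_mem (ρ.pick_mem _ _ _ _)).trans_le (Finset.card_le_univ _)
    · refine (Finset.card_le_card (MulState.read_avail_subset S ρ p.1 _ x)).trans_lt ?_
      simpa [MulState.fill, hx] using ih x

/-- The state `s` has the buffers `D` and the simulated history `h`, the rewards being obtained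
from the noise `η`. -/
structure MulState.Matches (θ : Act d) (η : ι × ℕ → ℝ) (s : MulState d ι) (D : BufState X ι)
    (h : List (Act d × ℝ)) : Prop where
  hist : s.hist = h
  avail : ∀ x : X, s.avail x = D.avail x
  val : ∀ (x : X) (b : ι), b ∈ D.avail x → s.val x b = inner ℝ θ (x : Act d) + η (b, D.stamp x)

theorem MulState.Matches.fill {θ : Act d} {η : ι × ℕ → ℝ} {s : MulState d ι} {D : BufState X ι}
    {h : List (Act d × ℝ)} {S : SingleAlg d X Ω} {w : Ω} (hs : s.Matches θ η D h)
    (he : s.avail (s.next S w) = ∅) {x : Act d} (hx : x = s.next S w) :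
    (s.fill S w fun a => (x, inner ℝ θ x + η (a, D.time))).Matches θ η
      (D.refill (S.request w h)) h := by
  classical
  subst hx
  have hn : s.next S w = (S.request w h : Act d) := by rw [MulState.next, hs.hist]; rfl
  have hD : ¬ (D.avail (S.request w h)).Nonempty := by
    rw [← hs.avail, ← hn, he]
    simp
  simp only [BufState.refill, hD, if_false]
  refine ⟨hs.hist, fun x => ?_, fun x b hb => ?_⟩ <;> by_cases hx : x = S.request w h
  · subst hx
    simp [MulState.fill, hn]
  · have hx' : (x : Act d) ≠ S.request w h := fun h => hx (Subtype.ext h)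
    simp [MulState.fill, hn, hx, hx', hs.avail]
  · subst hx
    simp [MulState.fill, hn]
  · have hx' : (x : Act d) ≠ S.request w h := fun h => hx (Subtype.ext h)
    simp only [ne_eq, hx, not_false_eq_true, Function.update_of_ne] at hb
    simpa [MulState.fill, hn, hx, hx'] using hs.val x b hb

variable [Nonempty ι]

theorem MulState.Matches.read {θ : Act d} {η : ι × ℕ → ℝ} {s : MulState d ι} {D : BufState X ι}
    {h : List (Act d × ℝ)} {S : SingleAlg d X Ω} {ρ : RemovalRule d ι} {w : Ω}
    (hs : s.Matches θ η (D.refill (S.request w h)) h) :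
    (s.read S ρ w).Matches θ η (D.advance S ρ w h)
      (h ++ [(S.act w h, inner ℝ θ (S.act w h) + η (D.readIdx S ρ w h))]) := by
  classical
  have hn : s.next S w = (S.request w h : Act d) := by rw [MulState.next, hs.hist]; rfl
  have hav : s.avail (s.next S w) = (D.refill (S.request w h)).avail (S.request w h) := by
    rw [hn, hs.avail]
  have hne : (s.avail (s.next S w)).Nonempty := hav ▸ D.refill_nonempty _
  have hb : ρ.pick s.hist (s.next S w) (s.avail (s.next S w)) hne =
      D.label ρ h (S.request w h) := by
    unfold BufState.label
    congr 1
    exact hs.hist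
  have hmem := D.label_mem ρ h (S.request w h)
  refine ⟨?_, fun x => ?_, fun x b hxb => ?_⟩
  · simp only [MulState.read, hne, dite_true, hb]
    rw [hn, hs.hist, hs.val _ _ hmem]
    rfl
  · simp only [MulState.read, hne, dite_true, hb, BufState.advance, BufState.take]
    by_cases hx : x = S.request w h
    · subst hx
      rw [hn, Function.update_self, Function.update_self, hs.avail]
    · have hx' : (x : Act d) ≠ s.next S w := by
        rw [hn]
        exact fun h => hx (Subtype.ext h)
      rw [Function.update_of_ne hx', Function.update_of_ne hx, hs.avail]
  · have : (s.read S ρ w).val = s.val := by simp [MulState.read, hne]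
    rw [this]
    exact hs.val x b (BufState.take_avail_subset _ _ _ _ hxb)

theorem ofFn_bufRun_succ (θ : Act d) (S : SingleAlg d X Ω) (ρ : RemovalRule d ι) (j : ℕ)
    (p : Ω × (ι × ℕ → ℝ)) :
    List.ofFn (bufRun θ S ρ (j + 1) p).2 = List.ofFn (bufRun θ S ρ j p).2 ++
      [S.outcome θ j p.1 (bufRun θ S ρ j p).2
        (p.2 ((bufRun θ S ρ j p).1.readIdx S ρ p.1 (List.ofFn (bufRun θ S ρ j p).2)))] := by
  rw [List.ofFn_succ_last]
  simp [bufRun]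

/-- An effective pass finds a non-empty buffer, so the machine advances without a refill and its
clock stands still; an idle pass corresponds to no step of the machine. -/
theorem MulState.Matches.iterate_read {θ : Act d} {S : SingleAlg d X Ω} {ρ : RemovalRule d ι}
    {p : Ω × (ι × ℕ → ℝ)} (m : ℕ) {j : ℕ} {s : MulState d ι}
    (hs : s.Matches θ p.2 (bufRun θ S ρ j p).1 (List.ofFn (bufRun θ S ρ j p).2)) :
    ∃ j', ((MulState.read S ρ p.1)^[m] s).Matches θ p.2 (bufRun θ S ρ j' p).1
      (List.ofFn (bufRun θ S ρ j' p).2) ∧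
      (bufRun θ S ρ j' p).1.time = (bufRun θ S ρ j p).1.time := by
  induction m generalizing j s with
  | zero => exact ⟨j, hs, rfl⟩
  | succ m ih =>
    rw [Function.iterate_succ_apply]
    by_cases h : (s.avail (s.next S p.1)).Nonempty
    · have hn : s.next S p.1 = (S.request p.1 (List.ofFn (bufRun θ S ρ j p).2) : Act d) := by
        rw [MulState.next, hs.hist]; rfl
      rw [hn, hs.avail] at h
      have hr := BufState.refill_of_nonempty h
      have hs' := MulState.Matches.read (S := S) (ρ := ρ) (w := p.1) (hr.symm ▸ hs)
      obtain ⟨j', h1, h2⟩ := ih (j := j + 1) (s := s.read S ρ p.1) (by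
        rw [ofFn_bufRun_succ]
        exact hs')
      refine ⟨j', h1, h2.trans ?_⟩
      change ((bufRun θ S ρ j p).1.refill _).time = _
      rw [hr]
    · rw [MulState.read_of_empty S ρ p.1 s (Finset.not_nonempty_iff_eq_empty.mp h)]
      exact ih hs

/-- At the beginning of every time-step, the state of the meta-algorithm is that of the machine
which reads rewards on demand, at an instant at which this machine needs a new time-step. -/
theorem BanditInstance.exists_matches_mulState (J : BanditInstance d ι) (S : SingleAlg d X Ω)
    (ρ : RemovalRule d ι) (p : Ω × (ι × ℕ → ℝ)) (t : ℕ) :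
    ∃ j, (J.mulState S ρ p t).Matches J.theta p.2 (bufRun J.theta S ρ j p).1
      (List.ofFn (bufRun J.theta S ρ j p).2) ∧ (bufRun J.theta S ρ j p).1.time = t := by
  induction t with
  | zero => exact ⟨0, ⟨rfl, fun x => rfl, fun x b hb => by simp [bufRun] at hb⟩, rfl⟩
  | succ t ih =>
    obtain ⟨j, hj, ht⟩ := ih
    rw [J.mulState_succ, MulState.round_eq]
    have he := J.mulState_avail_next S ρ p t
    have hf := hj.fill he rfl
    rw [ht] at hf
    obtain ⟨m, hm⟩ := Nat.exists_eq_succ_of_ne_zero ((J.mulState S ρ p t).size_fill_pos S p.1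
      fun a => (J.mulAct S ρ p t, inner ℝ J.theta (J.mulAct S ρ p t) + p.2 (a, t))).ne'
    rw [MulState.drain, hm, Function.iterate_succ_apply]
    have hr := MulState.Matches.read (S := S) (ρ := ρ) (w := p.1) hf
    obtain ⟨j', h1, h2⟩ := MulState.Matches.iterate_read (S := S) (ρ := ρ) (p := p) m (j := j + 1)
      (s := _) (by rw [ofFn_bufRun_succ]; exact hr)
    refine ⟨j', h1, h2.trans ?_⟩
    change ((bufRun J.theta S ρ j p).1.refill _).time = _
    have hn : (J.mulState S ρ p t).next S p.1 =
        (S.request p.1 (List.ofFn (bufRun J.theta S ρ j p).2) : Act d) := by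
      rw [MulState.next, hj.hist]; rfl
    have hD : ¬ ((bufRun J.theta S ρ j p).1.avail
        (S.request p.1 (List.ofFn (bufRun J.theta S ρ j p).2))).Nonempty := by
      rw [← hj.avail, ← hn]
      unfold BanditInstance.mulAct at he
      rw [he]
      simp
    simp [BufState.refill, hD, ht]

end Link

/-! ## Regret of the meta-algorithm and of the single-agent algorithm -/

section Gap

variable {d : ℕ}

/-- The regret of one play of `x`. -/
noncomputable def actionGap (θ : Act d) (X : Finset (Act d)) (x : Act d) : ℝ :=
  sSup ((fun x => inner ℝ θ x) '' (X : Set (Act d))) - inner ℝ θ x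

theorem actionGap_nonneg {θ : Act d} {X : Finset (Act d)} {x : Act d} (hx : x ∈ X) :
    0 ≤ actionGap θ X x :=
  sub_nonneg.mpr (le_csSup (X.finite_toSet.image _).bddAbove ⟨x, hx, rfl⟩)

theorem actionGap_le {θ : Act d} {X : Finset (Act d)} {x : Act d} (hx : x ∈ X) :
    actionGap θ X x ≤ maxGap θ X :=
  sub_le_sub_left (csInf_le (X.finite_toSet.image _).bddBelow ⟨x, hx, rfl⟩) _

theorem measurable_actionGap (θ : Act d) (X : Finset (Act d)) : Measurable (actionGap θ X) :=
  measurable_const.sub (measurable_const.inner measurable_id)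

variable {Ω : Type*} [MeasurableSpace Ω] {P : Measure Ω} [IsProbabilityMeasure P]
  {X : Finset (Act d)} {Y : Ω → Act d}

theorem integrable_actionGap (θ : Act d) (hY : Measurable Y) (hX : ∀ w, Y w ∈ X) :
    Integrable (fun w => actionGap θ X (Y w)) P := by
  refine Integrable.of_bound (C := maxGap θ X)
    ((measurable_actionGap θ X).comp hY).aestronglyMeasurable (Filter.Eventually.of_forall fun w => ?_)
  rw [Real.norm_of_nonneg (actionGap_nonneg (hX w))]
  exact actionGap_le (hX w)

theorem sSup_sub_integral_inner (θ : Act d) (hY : Measurable Y) (hX : ∀ w, Y w ∈ X) :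
    sSup ((fun x => inner ℝ θ x) '' (X : Set (Act d))) - ∫ w, inner ℝ θ (Y w) ∂P =
      ∫ w, actionGap θ X (Y w) ∂P := by
  have h1 : Integrable (fun w => actionGap θ X (Y w)) P := integrable_actionGap θ hY hX
  have h2 : (fun w => (inner ℝ θ (Y w) : ℝ)) =
      fun w => sSup ((fun x => inner ℝ θ x) '' (X : Set (Act d))) - actionGap θ X (Y w) := by
    funext w
    simp [actionGap]
  rw [h2, integral_sub (integrable_const _) h1]
  simp

theorem integral_actionGap_mem (θ : Act d) (hY : Measurable Y) (hX : ∀ w, Y w ∈ X) :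
    0 ≤ ∫ w, actionGap θ X (Y w) ∂P ∧ ∫ w, actionGap θ X (Y w) ∂P ≤ maxGap θ X := by
  refine ⟨integral_nonneg fun w => actionGap_nonneg (hX w), ?_⟩
  refine (integral_mono (integrable_actionGap θ hY hX) (integrable_const (maxGap θ X))
    fun w => actionGap_le (hX w)).trans ?_
  simp

end Gap

/-! ### The single-agent run and its regret per step -/

section SingleHistory

variable {d : ℕ} {ι Ω : Type*} {X : Finset (Act d)} [MeasurableSpace Ω]

/-- The history of the single-agent algorithm run by agent `i`. -/
noncomputable def singleHist (θ : Act d) (S : SingleAlg d X Ω) (i : ι) :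
    ∀ j, Ω × (ι × ℕ → ℝ) → (Fin j → Act d × ℝ)
  | 0, _ => Fin.elim0
  | j + 1, p => Fin.snoc (singleHist θ S i j p)
      (S.outcome θ j p.1 (singleHist θ S i j p) (p.2 (i, j)))

theorem BanditInstance.history_map_eq_singleHist (J : BanditInstance d ι) (S : SingleAlg d X Ω)
    (i : ι) (p : Ω × (ι × ℕ → ℝ)) (t : ℕ) :
    (J.history (fun w H _ => S.act w (H.map fun q => q i)) p.1 p.2 t).map (fun q => q i) =
      List.ofFn (singleHist J.theta S i t p) := by
  induction t with
  | zero => rfl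
  | succ t ih =>
    rw [List.ofFn_succ_last]
    simp [BanditInstance.history, ih, singleHist, SingleAlg.outcome]

theorem measurable_singleHist (θ : Act d) (S : SingleAlg d X Ω) (i : ι) (j : ℕ) :
    Measurable (singleHist θ S i j) := by
  induction j with
  | zero => exact measurable_const
  | succ j ih =>
    exact measurable_fin_snoc.comp (ih.prodMk ((S.measurable_outcome θ j).comp
      ((measurable_fst.prodMk ih).prodMk ((measurable_pi_apply (i, j)).comp measurable_snd))))

theorem singleHist_update [DecidableEq ι] (θ : Act d) (S : SingleAlg d X Ω) (i : ι) (j : ℕ) (w : Ω)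
    (η : ι × ℕ → ℝ) (z : ℝ) {k : ι × ℕ} (hk : j ≤ k.2) :
    singleHist θ S i j (w, Function.update η k z) = singleHist θ S i j (w, η) := by
  induction j with
  | zero => rfl
  | succ j ih =>
    have hne : (i, j) ≠ k := by
      rintro rfl
      exact absurd hk (by simp)
    simp only [singleHist, ih (by omega), Function.update_of_ne hne]

theorem adaptiveReading_singleHist [DecidableEq ι] (θ : Act d) (S : SingleAlg d X Ω) (i : ι) :
    AdaptiveReading (S.outcome θ) (singleHist θ S i) (fun j _ => (i, j)) where
  measurable_hist := measurable_singleHist θ S i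
  measurable_idx j k := MeasurableSet.const ((i, j) = k)
  step _ _ := rfl
  hist_update j w η z := singleHist_update θ S i j w η z le_rfl
  idx_update _ _ _ _ := rfl

/-- The expected regret of step `j + 1` of the single-agent algorithm. -/
noncomputable def SingleAlg.stepRegret (S : SingleAlg d X Ω) (P : Measure Ω) (ν : Measure ℝ)
    (θ : Act d) (j : ℕ) : ℝ :=
  ∫ q, actionGap θ X (S.act q.1 (List.ofFn q.2)) ∂adaptiveLaw P ν (S.outcome θ) j

/-- Applied both to a solitary agent reading its own noise in order and to the buffered run, this
identifies their expected regrets step by step. -/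
theorem AdaptiveReading.integral_actionGap {κ : Type*} [DecidableEq κ] [Countable κ]
    {P : Measure Ω} [IsProbabilityMeasure P] {ν : Measure ℝ} [IsProbabilityMeasure ν] {θ : Act d}
    {S : SingleAlg d X Ω} {H : ∀ j, Ω × (κ → ℝ) → (Fin j → Act d × ℝ)}
    {idx : ℕ → Ω × (κ → ℝ) → κ} (h : AdaptiveReading (S.outcome θ) H idx) (j : ℕ) :
    ∫ p, actionGap θ X (S.act p.1 (List.ofFn (H j p)))
      ∂(P.prod (Measure.infinitePi fun _ : κ => ν)) = S.stepRegret P ν θ j := by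
  rw [SingleAlg.stepRegret, ← h.map_eq (S.measurable_outcome θ) j, integral_map]
  · exact (measurable_fst.prodMk (h.measurable_hist j)).aemeasurable
  · exact ((measurable_actionGap θ X).comp (S.measurable_act j)).aestronglyMeasurable

theorem BanditInstance.singleRegret_eq {A : Type*} {P : Measure Ω}
    [IsProbabilityMeasure P] {I : BanditInstance d A} (hX : I.IsFixed X) (S : SingleAlg d X Ω)
    (a : A) (N : ℕ) :
    I.singleRegret P S a N = ∑ j ∈ Finset.range N, S.stepRegret P I.noise I.theta j := by
  classical
  have := I.noise_prob
  rw [BanditInstance.singleRegret, BanditInstance.regret]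
  refine Finset.sum_congr rfl fun j _ => ?_
  rw [← (adaptiveReading_singleHist I.theta S
    (⟨a, Finset.mem_singleton_self a⟩ : ({a} : Finset A))).integral_actionGap j]
  rw [← sSup_sub_integral_inner I.theta]
  · simp only [BanditInstance.restrict, hX a j]
    congr 2
    funext p
    have := (I.restrict {a}).history_map_eq_singleHist S ⟨a, Finset.mem_singleton_self a⟩ p j
    simp only [BanditInstance.restrict] at this
    rw [this]
  · exact (S.measurable_act j).comp (measurable_fst.prodMk (measurable_singleHist _ _ _ _))
  · exact fun p => S.act_mem _ _

theorem SingleAlg.stepRegret_mem (S : SingleAlg d X Ω) (P : Measure Ω) [IsProbabilityMeasure P]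
    (ν : Measure ℝ) [IsProbabilityMeasure ν] (θ : Act d) (j : ℕ) :
    0 ≤ S.stepRegret P ν θ j ∧ S.stepRegret P ν θ j ≤ maxGap θ X := by
  rw [← (adaptiveReading_singleHist θ S ()).integral_actionGap j]
  exact integral_actionGap_mem θ
    ((S.measurable_act j).comp (measurable_fst.prodMk (measurable_singleHist _ _ _ _)))
    fun p => S.act_mem _ _

end SingleHistory

/-! ### Comparing the plays of a coalition with the simulated plays -/

section MulRegret

variable {d : ℕ} {ι Ω : Type*} {X : Finset (Act d)} [MeasurableSpace Ω] [Fintype ι] [Nonempty ι]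

/-- The action requested after `j` rewards have been removed. -/
noncomputable def bufAct (θ : Act d) (S : SingleAlg d X Ω) (ρ : RemovalRule d ι) (j : ℕ)
    (p : Ω × (ι × ℕ → ℝ)) : Act d :=
  S.act p.1 (List.ofFn (bufRun θ S ρ j p).2)

/-- After `j` rewards have been removed, a new time-step is needed to proceed. -/
def NeedsRound (θ : Act d) (S : SingleAlg d X Ω) (ρ : RemovalRule d ι) (j : ℕ)
    (p : Ω × (ι × ℕ → ℝ)) : Prop :=
  (bufRun θ S ρ j p).1.avail (S.request p.1 (List.ofFn (bufRun θ S ρ j p).2)) = ∅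

theorem monotone_time_bufRun (θ : Act d) (S : SingleAlg d X Ω) (ρ : RemovalRule d ι)
    (p : Ω × (ι × ℕ → ℝ)) : Monotone fun j => (bufRun θ S ρ j p).1.time :=
  monotone_nat_of_le_succ fun _ => BufState.time_le_refill _ _

theorem NeedsRound.time_lt {θ : Act d} {S : SingleAlg d X Ω} {ρ : RemovalRule d ι} {j j' : ℕ}
    {p : Ω × (ι × ℕ → ℝ)} (h : NeedsRound θ S ρ j p) (hj : j < j') :
    (bufRun θ S ρ j p).1.time < (bufRun θ S ρ j' p).1.time := by
  refine lt_of_lt_of_le ?_ (monotone_time_bufRun θ S ρ p (Nat.succ_le_of_lt hj))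
  change _ < ((bufRun θ S ρ j p).1.refill _).time
  unfold NeedsRound at h
  simp [BufState.refill, h]

theorem BanditInstance.exists_mulAct_eq_bufAct (J : BanditInstance d ι) (S : SingleAlg d X Ω)
    (ρ : RemovalRule d ι) (p : Ω × (ι × ℕ → ℝ)) (t : ℕ) :
    ∃ j, (bufRun J.theta S ρ j p).1.time = t ∧ NeedsRound J.theta S ρ j p ∧
      J.mulAct S ρ p t = bufAct J.theta S ρ j p := by
  obtain ⟨j, hj, ht⟩ := J.exists_matches_mulState S ρ p t
  have hn : J.mulAct S ρ p t = bufAct J.theta S ρ j p := by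
    rw [BanditInstance.mulAct, MulState.next, hj.hist]
    rfl
  refine ⟨j, ht, ?_, hn⟩
  unfold NeedsRound
  rw [← hj.avail]
  have := J.mulState_avail_next S ρ p t
  rwa [hn] at this

theorem measurable_bufAct (θ : Act d) (S : SingleAlg d X Ω) (ρ : RemovalRule d ι) (j : ℕ) :
    Measurable (bufAct θ S ρ j) :=
  (S.measurable_act j).comp (measurable_fst.prodMk (measurable_bufRun θ S ρ j).2)

/-- The number of removals made before a given time-step is random, so the event is split by this
number. It is unique, since the clock strictly increases past an instant that needs a new time-step.
-/
theorem BanditInstance.measurable_mulAct (J : BanditInstance d ι) (S : SingleAlg d X Ω)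
    (ρ : RemovalRule d ι) (t : ℕ) : Measurable fun p => J.mulAct S ρ p t := by
  intro B hB
  have : (fun p => J.mulAct S ρ p t) ⁻¹' B =
      ⋃ j, {p | (bufRun J.theta S ρ j p).1.time = t ∧ NeedsRound J.theta S ρ j p} ∩
        bufAct J.theta S ρ j ⁻¹' B := by
    ext p
    obtain ⟨j, h1, h2, h3⟩ := J.exists_mulAct_eq_bufAct S ρ p t
    simp only [Set.mem_preimage, Set.mem_iUnion, Set.mem_inter_iff, Set.mem_ofPred_eq]
    constructor
    · intro h
      exact ⟨j, ⟨h1, h2⟩, h3 ▸ h⟩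
    · rintro ⟨j', ⟨h1', h2'⟩, h3'⟩
      have : j = j' := by
        rcases lt_trichotomy j j' with h | h | h
        · exact absurd (h2.time_lt h) (by omega)
        · exact h
        · exact absurd (h2'.time_lt h) (by omega)
      subst this
      rw [h3]
      exact h3'
  rw [this]
  refine MeasurableSet.iUnion fun j => MeasurableSet.inter ?_ (measurable_bufAct _ S ρ j hB)
  have ih := measurable_bufRun J.theta S ρ j
  have hc := measurableSet_bufCode J.theta S ρ j ih.1 ih.2
  have := (measurableSet_comp_eq (bufCode J.theta S ρ j) hc
    (fun c => (c.1.time, c.1.avail c.2.1)) (t, ∅))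
  simp only [Prod.mk.injEq] at this
  exact this

theorem sum_map_ofFn_bufRun (g : Act d → ℝ) (θ : Act d) (S : SingleAlg d X Ω)
    (ρ : RemovalRule d ι) (j : ℕ) (p : Ω × (ι × ℕ → ℝ)) :
    ((List.ofFn (bufRun θ S ρ j p).2).map fun q => g q.1).sum =
      ∑ i ∈ Finset.range j, g (bufAct θ S ρ i p) := by
  induction j with
  | zero => simp
  | succ j ih =>
    rw [ofFn_bufRun_succ, List.map_append, List.sum_append, ih, Finset.sum_range_succ]
    simp [SingleAlg.outcome, bufAct]

/-- The plays of the meta-algorithm and equally many plays of the simulated algorithm differ only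
by the plays whose rewards are in the buffers. -/
theorem BanditInstance.abs_sum_mulAct_sub_le (J : BanditInstance d ι) (S : SingleAlg d X Ω)
    (ρ : RemovalRule d ι) (p : Ω × (ι × ℕ → ℝ)) (T : ℕ) {g : Act d → ℝ} {D : ℝ}
    (hg : ∀ x ∈ X, 0 ≤ g x ∧ g x ≤ D) :
    |Fintype.card ι * ∑ s ∈ Finset.range T, g (J.mulAct S ρ p s) -
      ∑ i ∈ Finset.range (Fintype.card ι * T), g (bufAct J.theta S ρ i p)| ≤
        ((Fintype.card ι : ℝ) - 1) * X.card * D := by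
  obtain ⟨j, hj, -⟩ := J.exists_matches_mulState S ρ p T
  have hD : 0 ≤ D := (hg _ (S.act_mem p.1 [])).1.trans (hg _ (S.act_mem p.1 [])).2
  have hw := J.weight_mulState g S ρ p T
  have h1 := J.weight_mulState (fun _ => 1) S ρ p T
  rw [MulState.weight, hj.hist, sum_map_ofFn_bufRun] at hw
  simp only [MulState.weight, hj.hist, List.map_const', List.length_ofFn, List.sum_replicate,
    Finset.sum_const, Finset.card_range, nsmul_eq_mul, mul_one] at h1
  set s := J.mulState S ρ p T
  set b := ∑ x ∈ X, (s.avail x).card with hb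
  -- Weight `1` counts rewards: all `card ι * T` of them are either simulated or buffered.
  have h1' : j + b = Fintype.card ι * T := by exact_mod_cast h1
  have hbn : (b : ℝ) ≤ ((Fintype.card ι : ℝ) - 1) * X.card := by
    rw [hb]
    push_cast
    have : ∀ x ∈ X, ((s.avail x).card : ℝ) ≤ (Fintype.card ι : ℝ) - 1 := fun x _ => by
      have : ((s.avail x).card + 1 : ℝ) ≤ Fintype.card ι := by
        exact_mod_cast J.card_avail_mulState_lt S ρ p T x
      linarith
    exact (Finset.sum_le_card_nsmul X _ _ this).trans (by rw [nsmul_eq_mul, mul_comm])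
  have hE : 0 ≤ ∑ x ∈ X, ((s.avail x).card : ℝ) * g x :=
    Finset.sum_nonneg fun x hx => mul_nonneg (Nat.cast_nonneg _) (hg x hx).1
  have hE' : ∑ x ∈ X, ((s.avail x).card : ℝ) * g x ≤ b * D := by
    rw [hb]
    push_cast
    rw [Finset.sum_mul]
    exact Finset.sum_le_sum fun x hx => mul_le_mul_of_nonneg_left (hg x hx).2 (Nat.cast_nonneg _)
  -- Both sums now share the first `j` simulated plays. What is left is the buffered plays on one
  -- side and the next `b` simulated plays on the other, each between `0` and `b * D`.
  rw [← h1', Finset.sum_range_add, ← hw]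
  have hF : 0 ≤ ∑ i ∈ Finset.range b, g (bufAct J.theta S ρ (j + i) p) :=
    Finset.sum_nonneg fun i _ => (hg _ (S.act_mem _ _)).1
  have hF' : ∑ i ∈ Finset.range b, g (bufAct J.theta S ρ (j + i) p) ≤ b * D := by
    refine (Finset.sum_le_card_nsmul _ _ D fun i _ => (hg _ (S.act_mem _ _)).2).trans ?_
    simp
  have hbD : b * D ≤ ((Fintype.card ι : ℝ) - 1) * X.card * D :=
    mul_le_mul_of_nonneg_right hbn hD
  rw [abs_le]
  constructor <;> linarith

theorem BanditInstance.abs_sum_integral_mulAct_sub_le (J : BanditInstance d ι) (P : Measure Ω)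
    [IsProbabilityMeasure P] (S : SingleAlg d X Ω) (ρ : RemovalRule d ι) (T : ℕ) :
    |Fintype.card ι * ∑ t ∈ Finset.range T, ∫ p, actionGap J.theta X (J.mulAct S ρ p t)
        ∂(P.prod (Measure.infinitePi fun _ : ι × ℕ => J.noise)) -
      ∑ j ∈ Finset.range (Fintype.card ι * T), S.stepRegret P J.noise J.theta j| ≤
        ((Fintype.card ι : ℝ) - 1) * X.card * maxGap J.theta X := by
  classical
  have := J.noise_prob
  set μ := P.prod (Measure.infinitePi fun _ : ι × ℕ => J.noise)
  have i1 : ∀ t, Integrable (fun p => actionGap J.theta X (J.mulAct S ρ p t)) μ := fun t =>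
    integrable_actionGap J.theta (J.measurable_mulAct S ρ t) fun p => S.act_mem _ _
  have i2 : ∀ j, Integrable (fun p => actionGap J.theta X (bufAct J.theta S ρ j p)) μ := fun j =>
    integrable_actionGap J.theta (measurable_bufAct J.theta S ρ j) fun p => S.act_mem _ _
  have e : ∀ j, S.stepRegret P J.noise J.theta j =
      ∫ p, actionGap J.theta X (bufAct J.theta S ρ j p) ∂μ := fun j =>
    ((adaptiveReading_bufRun J.theta S ρ).integral_actionGap j).symm
  simp only [e]
  rw [← integral_finsetSum _ fun t _ => i1 t, ← integral_finsetSum _ fun j _ => i2 j,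
    ← integral_const_mul, ← integral_sub ((integrable_finsetSum _ fun t _ => i1 t).const_mul _)
      (integrable_finsetSum _ fun j _ => i2 j)]
  have hb := norm_integral_le_of_norm_le_const (μ := μ) (Filter.Eventually.of_forall
    fun p => (Real.norm_eq_abs _).trans_le (J.abs_sum_mulAct_sub_le S ρ p T
      (g := actionGap J.theta X) fun x hx => ⟨actionGap_nonneg hx, actionGap_le hx⟩))
  rwa [probReal_univ, mul_one, Real.norm_eq_abs] at hb

end MulRegret

/-! ### Value of a coalition in terms of the single-agent regret -/

section Value

variable {d : ℕ} {A Ω : Type*} {X : Finset (Act d)} [MeasurableSpace Ω]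
  {P : Measure Ω} {I : BanditInstance d A}

theorem BanditInstance.value_mul_empty (S : SingleAlg d X Ω)
    (ρ : ∀ C : Finset A, RemovalRule d C) (T : ℕ) :
    I.value P (fun C => mul S (ρ C)) T ∅ = 0 := by
  simp [BanditInstance.value]

variable [IsProbabilityMeasure P]

theorem BanditInstance.value_mul_eq (hX : I.IsFixed X) (S : SingleAlg d X Ω)
    (ρ : ∀ C : Finset A, RemovalRule d C) (T : ℕ) {C : Finset A} [Nonempty C] :
    I.value P (fun C => mul S (ρ C)) T C =
      -(C.card * ∑ t ∈ Finset.range T,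
        ∫ p, actionGap I.theta X ((I.restrict C).mulAct S (ρ C) p t)
          ∂(P.prod (Measure.infinitePi fun _ : C × ℕ => I.noise))) := by
  have := I.noise_prob
  rw [BanditInstance.value, neg_inj]
  have : ∀ a : C, (I.restrict C).regret P (mul S (ρ C)) T a = ∑ t ∈ Finset.range T,
        ∫ p, actionGap I.theta X ((I.restrict C).mulAct S (ρ C) p t)
          ∂(P.prod (Measure.infinitePi fun _ : C × ℕ => I.noise)) := fun a => by
    refine Finset.sum_congr rfl fun t _ => ?_
    rw [← sSup_sub_integral_inner I.theta ((I.restrict C).measurable_mulAct S (ρ C) t)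
      fun p => S.act_mem _ _]
    simp only [BanditInstance.restrict, hX a t]
    rfl
  rw [Finset.sum_congr rfl fun a _ => this a]
  simp

/-- The loss of a non-empty coalition is the regret of as many plays of the single-agent
algorithm, up to the plays whose rewards remain in the buffers. -/
theorem BanditInstance.abs_value_mul_add_le (hX : I.IsFixed X) (S : SingleAlg d X Ω)
    (ρ : ∀ C : Finset A, RemovalRule d C) (T : ℕ) {C : Finset A} (hC : C.Nonempty) :
    |I.value P (fun C => mul S (ρ C)) T C +
      ∑ j ∈ Finset.range (C.card * T), S.stepRegret P I.noise I.theta j| ≤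
        ((C.card : ℝ) - 1) * X.card * maxGap I.theta X := by
  have := hC.to_subtype
  have h := (I.restrict C).abs_sum_integral_mulAct_sub_le P S (ρ C) T
  rw [I.value_mul_eq hX S ρ T, ← abs_neg]
  simp only [Fintype.card_coe] at h
  rw [neg_add, neg_neg, ← sub_eq_add_neg]
  exact h

/-- The first action is chosen without feedback, so the game with horizon `1` is additive. This
horizon is separate because the argument for the empty coalition needs `h = T - 1 ≥ 1`. -/
theorem BanditInstance.value_mul_one (hX : I.IsFixed X) (S : SingleAlg d X Ω)
    (ρ : ∀ C : Finset A, RemovalRule d C) (C : Finset A) :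
    I.value P (fun C => mul S (ρ C)) 1 C =
      -(C.card * ∫ w, actionGap I.theta X (S.act w []) ∂P) := by
  have := I.noise_prob
  rcases C.eq_empty_or_nonempty with rfl | hC
  · simp [BanditInstance.value]
  · have := hC.to_subtype
    rw [I.value_mul_eq hX S ρ 1, Finset.sum_range_one]
    change -((C.card : ℝ) * ∫ p : Ω × (C × ℕ → ℝ), (fun w => actionGap I.theta X (S.act w [])) p.1
      ∂(P.prod (Measure.infinitePi fun _ : C × ℕ => I.noise))) = _
    rw [integral_fun_fst (fun w => actionGap I.theta X (S.act w []))]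
    simp

end Value

/-! ## Convexity of the game -/

theorem mixedDiff_le_of_discDeriv2_le {R : ℕ → ℝ} {t g h : ℕ} {u : ℝ} (hg : 1 ≤ g) (hh : 1 ≤ h)
    (H : discDeriv2 R t g h ≤ -u) :
    R (t + g + h) - R (t + g) - (R (t + h) - R t) ≤ -(u * g * h) := by
  have hg' : (0 : ℝ) < g := by exact_mod_cast hg
  have hh' : (0 : ℝ) < h := by exact_mod_cast hh
  rw [discDeriv2, discDeriv, discDeriv, div_le_iff₀ hg', ← sub_div, div_le_iff₀ hh'] at H
  linarith

/-- A game in which the loss of a coalition of size `n` is the sum of the first `n * T` terms of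
`r`, up to an error proportional to `n - 1`, is convex if these sums are sufficiently concave. -/
theorem isConvexGame_of_discDeriv2_le {A : Type*} [Fintype A] [DecidableEq A]
    {v : Finset A → ℝ} {r : ℕ → ℝ} {B : ℝ} {T : ℕ} {u : ℕ → ℝ} (hT : 2 ≤ T)
    (hr : ∀ j, 0 ≤ r j ∧ r j ≤ B) (hv₀ : v ∅ = 0)
    (hv : ∀ C : Finset A, C.Nonempty →
      |v C + ∑ j ∈ Finset.range (C.card * T), r j| ≤ ((C.card : ℝ) - 1) * B)
    (hconc : ∀ t g h, 1 ≤ t → 1 ≤ g → 1 ≤ h → t + g + h ≤ Fintype.card A * T →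
      discDeriv2 (fun N => ∑ j ∈ Finset.range N, r j) t g h ≤ -u t)
    (hu : ∀ t, 1 ≤ t → t ≤ Fintype.card A * T → 4 * Fintype.card A * B ≤ u t * T ^ 2) :
    IsConvexGame v := by
  intro i C D hCD hi
  have hB : 0 ≤ B := (hr 0).1.trans (hr 0).2
  rcases hCD.eq_or_ssubset with rfl | hss
  · exact le_rfl
  have hlt := Finset.card_lt_card hss
  have hiC : i ∉ C := fun h => hi (hCD h)
  have hm : D.card + 1 ≤ Fintype.card A := by
    rw [← Finset.card_insert_of_notMem hi]
    exact Finset.card_le_univ _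
  have h1 := hv (insert i C) (Finset.insert_nonempty _ _)
  have h2 := hv (insert i D) (Finset.insert_nonempty _ _)
  have h3 := hv D (Finset.card_pos.mp (by omega))
  rw [Finset.card_insert_of_notMem hiC] at h1
  rw [Finset.card_insert_of_notMem hi] at h2
  push_cast at h1 h2
  rw [abs_le] at h1 h2 h3
  have hqT : (D.card + 1) * T ≤ Fintype.card A * T := Nat.mul_le_mul_right _ hm
  have hm' : (D.card : ℝ) + 1 ≤ Fintype.card A := by exact_mod_cast hm
  rcases C.eq_empty_or_nonempty with rfl | hC
  · have hq : 1 ≤ D.card := by simpa using hlt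
    have hq' : (1 : ℝ) ≤ D.card := by exact_mod_cast hq
    -- With `t = 1`, `g = |D|T`, `h = T - 1` the mixed difference compares steps `2, …, T` with the
    -- last `T - 1` steps before `(|D| + 1)T`.
    have e : 1 + D.card * T + (T - 1) = (D.card + 1) * T := by
      rw [Nat.add_mul]
      omega
    have hone : 1 ≤ Fintype.card A * T := Nat.mul_pos (by omega) (by omega)
    have hc := mixedDiff_le_of_discDeriv2_le (Nat.mul_pos hq (by omega)) (by omega)
      (hconc 1 (D.card * T) (T - 1) le_rfl (Nat.mul_pos hq (by omega)) (by omega)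
        (by rw [e]; exact hqT))
    rw [e, show 1 + (T - 1) = T by omega, add_comm 1 (D.card * T), Finset.sum_range_succ,
      Finset.sum_range_one] at hc
    push_cast [Nat.cast_sub (show 1 ≤ T by omega)] at hc
    have hu1 := hu 1 le_rfl hone
    have hT' : (2 : ℝ) ≤ T := by exact_mod_cast hT
    -- The sign of `u 1` is forced by `hu`, as `B ≥ 0`.
    have hupos : 0 ≤ u 1 := by
      by_contra hneg
      have h4 : 0 ≤ 4 * (Fintype.card A : ℝ) * B := by positivity
      nlinarith [mul_neg_of_neg_of_pos (not_le.mp hneg) (show (0 : ℝ) < (T : ℝ) ^ 2 by positivity)]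
    -- The error to beat: `|D|B` and `(|D| - 1)B` from the two large coalitions, and `B` for the
    -- omitted step `r (|D|T)`. The proof uses `T ≤ 2(T - 1)`.
    have key : 2 * D.card * B ≤ u 1 * (D.card * T) * (T - 1) := by
      have a1 : u 1 * (T : ℝ) ^ 2 ≤ 2 * (u 1 * T * (T - 1)) := by
        nlinarith [mul_nonneg (mul_nonneg hupos (show (0 : ℝ) ≤ T by linarith))
          (show (0 : ℝ) ≤ (T : ℝ) - 2 by linarith)]
      have a2 : 2 * B ≤ 2 * (Fintype.card A : ℝ) * B :=
        mul_le_mul_of_nonneg_right (by linarith) hB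
      have a3 : 2 * B ≤ u 1 * T * (T - 1) := by linarith
      calc 2 * D.card * B = D.card * (2 * B) := by ring
        _ ≤ D.card * (u 1 * T * (T - 1)) := mul_le_mul_of_nonneg_left a3 (by linarith)
        _ = _ := by ring
    simp only [Finset.card_empty, zero_add, one_mul, Nat.cast_zero, sub_self, zero_mul] at h1
    have hr0 := (hr 0).1
    have hr1 := (hr (D.card * T)).2
    rw [hv₀]
    have h1u := h1.2
    have h2l := h2.1
    have h3u := h3.2
    ring_nf at key hc h1u h2l h3u ⊢
    linarith
  · have hs : 1 ≤ C.card := hC.card_pos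
    have h4 := hv C hC
    rw [abs_le] at h4
    have e1 : C.card * T + (D.card - C.card) * T = D.card * T := by
      rw [← Nat.add_mul, Nat.add_sub_cancel' hlt.le]
    have e2 : D.card * T + T = (D.card + 1) * T := by ring
    have e3 : C.card * T + T = (C.card + 1) * T := by ring
    have hsT : 1 ≤ C.card * T := Nat.mul_pos hs (by omega)
    have hgT : 1 ≤ (D.card - C.card) * T := Nat.mul_pos (by omega) (by omega)
    have hc := mixedDiff_le_of_discDeriv2_le hgT (by omega)
      (hconc (C.card * T) ((D.card - C.card) * T) T hsT hgT (by omega)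
        (by rw [e1, e2]; exact hqT))
    rw [e1, e2, e3] at hc
    have hu1 := hu (C.card * T) hsT ((Nat.mul_le_mul_right _ (by omega)).trans hqT)
    push_cast [Nat.cast_sub hlt.le] at hc
    have hlt' : (C.card : ℝ) + 1 ≤ D.card := by exact_mod_cast hlt
    have hBm : 0 ≤ 4 * (Fintype.card A : ℝ) * B := by positivity
    have a1 : 4 * Fintype.card A * B ≤ u (C.card * T) * ((D.card - C.card) * T) * T := by
      calc 4 * Fintype.card A * B ≤ ((D.card : ℝ) - C.card) * (4 * Fintype.card A * B) :=
            le_mul_of_one_le_left hBm (by linarith)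
        _ ≤ ((D.card : ℝ) - C.card) * (u (C.card * T) * T ^ 2) :=
            mul_le_mul_of_nonneg_left hu1 (by linarith)
        _ = _ := by ring
    -- The four errors `|C|`, `|D|`, `|D| - 1`, `|C| - 1` (times `B`) sum to less than the left-hand
    -- side.
    have a2 : (2 * (C.card : ℝ) + 2 * D.card) * B ≤ 4 * Fintype.card A * B :=
      mul_le_mul_of_nonneg_right (by linarith) hB
    linarith [h1.2, h2.1, h3.2, h4.1]

/-! ### Convexity of the bandit game and the thresholds on the horizon -/

section

variable {d : ℕ} {A Ω : Type*} [Fintype A] [DecidableEq A] [MeasurableSpace Ω] {P : Measure Ω}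
  [IsProbabilityMeasure P] {I : BanditInstance d A} {X : Finset (Act d)}

theorem isConvexGame_value_mul (hX : I.IsFixed X) (S : SingleAlg d X Ω)
    (ρ : ∀ C : Finset A, RemovalRule d C) (a : A) {T : ℕ} {u : ℕ → ℝ}
    (hconc : ∀ t g h, 1 ≤ t → 1 ≤ g → 1 ≤ h → t + g + h ≤ Fintype.card A * T →
      discDeriv2 (I.singleRegret P S a) t g h ≤ -u t)
    (hu : ∀ t, 1 ≤ t → t ≤ Fintype.card A * T →
      4 * Fintype.card A * X.card * maxGap I.theta X ≤ u t * T ^ 2) :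
    IsConvexGame (I.value P (fun C => mul S (ρ C)) T) := by
  have := I.noise_prob
  rcases T with _ | _ | T
  · intro i C D _ _
    simp [BanditInstance.value, BanditInstance.regret]
  · intro i C D hCD hi
    simp only [zero_add, I.value_mul_one hX, Finset.card_insert_of_notMem hi,
      Finset.card_insert_of_notMem fun h => hi (hCD h)]
    push_cast
    exact le_of_eq (by ring)
  · have hR : I.singleRegret P S a =
        fun N => ∑ j ∈ Finset.range N, S.stepRegret P I.noise I.theta j :=
      funext fun N => I.singleRegret_eq hX S a N
    rw [hR] at hconc
    have hr := S.stepRegret_mem P I.noise I.theta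
    -- Some action is requested, so `X` is non-empty and `r j ≤ D ≤ KD`.
    obtain ⟨w⟩ : Nonempty Ω := nonempty_of_isProbabilityMeasure P
    have hK : (1 : ℝ) ≤ X.card := by
      exact_mod_cast Finset.card_pos.mpr ⟨_, S.act_mem w []⟩
    have hD : 0 ≤ maxGap I.theta X := (hr 0).1.trans (hr 0).2
    refine isConvexGame_of_discDeriv2_le (B := X.card * maxGap I.theta X) (by omega)
      (fun j => ⟨(hr j).1, (hr j).2.trans (le_mul_of_one_le_left hD hK)⟩)
      (I.value_mul_empty S ρ _) (fun C hC => ?_) hconc fun t h1 h2 => ?_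
    · rw [← mul_assoc]
      exact I.abs_value_mul_add_le hX S ρ _ hC
    · rw [← mul_assoc]
      exact hu t h1 h2

end

/-- The threshold is the value of `T` at which the conclusion is an equality: the powers of `T`
combine to `T ^ ε`, and those of `m` to `m ^ (3 - ε)`. -/
theorem le_margin_mul_sq_of_rpow_le {m K T c ε D : ℝ} (hm : 0 < m) (hT : 0 < T) (hc : 0 < c)
    (hε : 0 < ε) (hK : 0 ≤ K * D)
    (h : (4 * K * D * m ^ (3 - ε) / c) ^ (1 / ε) ≤ T) :
    4 * m * K * D ≤ c * (m * T) ^ (-2 + ε) * T ^ 2 := by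
  have h0 : 0 ≤ 4 * K * D * m ^ (3 - ε) / c := by
    have : 0 ≤ 4 * (K * D) * m ^ (3 - ε) / c := by positivity
    simpa [mul_assoc] using this
  have h1 : 4 * K * D * m ^ (3 - ε) / c ≤ T ^ ε := by
    have := Real.rpow_le_rpow (by positivity) h hε.le
    rwa [← Real.rpow_mul h0, one_div, inv_mul_cancel₀ hε.ne', Real.rpow_one] at this
  rw [div_le_iff₀ hc] at h1
  have e1 : (m * T) ^ (-2 + ε) * T ^ 2 = m ^ (-2 + ε) * T ^ ε := by
    rw [Real.mul_rpow hm.le hT.le, mul_assoc, ← Real.rpow_natCast T 2, ← Real.rpow_add hT]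
    congr 2
    push_cast
    ring
  have e2 : m ^ (3 - ε) * m ^ (-2 + ε) = m := by
    rw [← Real.rpow_add hm]
    ring_nf
    exact Real.rpow_one m
  calc 4 * m * K * D = 4 * K * D * (m ^ (3 - ε) * m ^ (-2 + ε)) := by rw [e2]; ring
    _ = (4 * K * D * m ^ (3 - ε)) * m ^ (-2 + ε) := by ring
    _ ≤ (T ^ ε * c) * m ^ (-2 + ε) := mul_le_mul_of_nonneg_right h1 (by positivity)
    _ = c * (m * T) ^ (-2 + ε) * T ^ 2 := by rw [mul_assoc c, e1]; ring

theorem mainTheorem1 {d : ℕ} {A : Type*} [Fintype A] [DecidableEq A]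
    {Ω : Type*} [MeasurableSpace Ω] (P : Measure Ω) [IsProbabilityMeasure P]
    (I : BanditInstance d A) (X : Finset (Act d)) (hX : I.IsFixed X)
    (S : SingleAlg d X Ω) (ρ : ∀ C : Finset A, RemovalRule d C) (a : A) :
    (∀ (T : ℕ) (υ : ℕ → ℝ) (c ε : ℝ), 0 < c → 0 < ε →
      RegretRate (I.singleRegret P S a) (Fintype.card A * T) υ c ε →
      (∀ t, 1 ≤ t → t ≤ Fintype.card A * T →
        Real.sqrt (4 * Fintype.card A * X.card * maxGap I.theta X / υ t) ≤ T) →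
      IsConvexGame (I.value P (fun C => mul S (ρ C)) T)) ∧
    (∀ c ε : ℝ, 0 < c → 0 < ε → ε < 2 →
      (∀ t g h : ℕ, 1 ≤ t → 1 ≤ g → 1 ≤ h →
        discDeriv2 (I.singleRegret P S a) t g h ≤ -(c * ((t + g + h : ℕ) : ℝ) ^ (-2 + ε))) →
      ∀ T : ℕ,
        (4 * X.card * maxGap I.theta X * (Fintype.card A : ℝ) ^ (3 - ε) / c) ^ (1 / ε) ≤ T →
        IsConvexGame (I.value P (fun C => mul S (ρ C)) T)) := by
  refine ⟨fun T υ c ε _ _ hR hT => ?_, fun c ε hc hε hε2 hR T hT => ?_⟩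
  · refine isConvexGame_value_mul hX S ρ a hR.strict_concave fun t h1 h2 => ?_
    have h := (Real.sqrt_le_left (Nat.cast_nonneg T)).mp (hT t h1 h2)
    rw [div_le_iff₀ (hR.margin_pos t h1 h2)] at h
    linarith
  · have := I.noise_prob
    have hm : 0 < Fintype.card A := Fintype.card_pos_iff.mpr ⟨a⟩
    refine isConvexGame_value_mul hX S ρ a
      -- Since `-2 + ε < 0`, the margin is smallest at the largest admissible `t + g + h`, and this
      -- value serves as a constant margin.
      (u := fun _ => c * ((Fintype.card A : ℝ) * T) ^ (-2 + ε))
      (fun t g h ht hg hh hN => (hR t g h ht hg hh).trans ?_) fun t h1 h2 => ?_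
    · refine neg_le_neg (mul_le_mul_of_nonneg_left ?_ hc.le)
      refine Real.rpow_le_rpow_of_nonpos (by exact_mod_cast (by omega : 0 < t + g + h)) ?_
        (by linarith)
      exact_mod_cast hN
    · have hT0 : 0 < T := Nat.pos_of_ne_zero fun h0 => by
        subst h0
        omega
      have hr := S.stepRegret_mem P I.noise I.theta 0
      exact le_margin_mul_sq_of_rpow_le (by exact_mod_cast hm) (by exact_mod_cast hT0) hc hε
        (mul_nonneg (Nat.cast_nonneg _) (hr.1.trans hr.2)) hT
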